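/- Let $(G,K)$ be a Riemannian symmetric pair of compact type: $G$ is a connected Lie group whose Lie algebra $\mathfrak g$ has negative definite Killing form, $\sigma$ is a smooth automorphism of $G$ with $\sigma^2=\mathrm{id}$, and $K$ is a closed subgroup of $G$ contained in the fixed point group $G^\sigma$ and containing the identity component of $G^\sigma$. (For instance, $G=I_0(M)$ is the identity component of the isometry group of an irreducible symmetric space $M$ of compact type and $K$ is the stabilizer of a point.) Let $\mathfrak p$ be the $(-1)$-eigenspace of $d\sigma$ on $\mathfrak g$, with the Euclidean structure given by minus the Killing form, and let $\mathfrak h_{\mathfrak p}\subseteq\mathfrak p$ be a maximal abelian subspace. For $\alpha\in\mathfrak h_{\mathfrak p}^*$ put $$\mathfrak g(\alpha)=\{X\in\mathfrak g \mid [H,[H,X]]=-\alpha(H)^2X\ \text{ for all } H\in\mathfrak h_{\mathfrak p}\},\qquad \mathfrak p(\alpha)=\mathfrak g(\alpha)\cap\mathfrak p .$$ Let $\Sigma=\{\alpha\in\mathfrak h_{\mathfrak p}^*\mid \alpha\neq0,\ \mathfrak g(\alpha)\neq0\}$ be the restricted root system and $\Sigma^+\subseteq\Sigma$ a set of positive roots,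 that is, for each $\alpha\in\Sigma$ exactly one of $\alpha,-\alpha$ lies in $\Sigma^+$, and $\alpha+\beta\in\Sigma^+$ whenever $\alpha,\beta\in\Sigma^+$ and $\alpha+\beta\in\Sigma$. Let $\mathbf x\in\mathfrak h_{\mathfrak p}$. Then the sum of the subspaces $\mathfrak p(\alpha)$ over the $\alpha\in\Sigma^+$ with $\alpha(\mathbf x)\neq0$ is direct, and $$T_{\mathbf x}\big(\mathrm{Ad}(K)\mathbf x\big)=p_0^{\mathbf x}\Big(\bigoplus_{\alpha\in\Sigma^+,\ \alpha(\mathbf x)\neq0}\mathfrak p(\alpha)\Big).$$ Here the left side is the tangent space at $\mathbf x$ of the orbit $\mathrm{Ad}(K)\mathbf x\subseteq\mathfrak p$, i.e. the set of velocities at $\mathbf x$ of smooth curves in $\mathfrak p$ that stay in the orbit, and $p_0^{\mathbf x}\colon T_0\mathfrak p\to T_{\mathbf x}\mathfrak p$ is Euclidean parallel translation, with $\mathfrak p$ identified with $T_0\mathfrak p$ in the natural way. -/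

import Mathlib

open scoped Manifold ContDiff Topology

noncomputable section

/-- Over `ℝ`, the smoothness exponent needed for the Lie bracket is at most `∞`. -/
instance leInfty_minSmoothness_real_three : ENat.LEInfty (minSmoothness ℝ 3) :=
  ⟨by
    rw [minSmoothness_of_isRCLikeNormedField]
    exact (inferInstance : ENat.LEInfty (3 : WithTop ℕ∞)).out⟩

/-! ### Tangent spaces of subsets of a Euclidean space, and parallel translation -/

section Euclidean

variable {V : Type*} [NormedAddCommGroup V] [NormedSpace ℝ V]

/-- The tangent space at `x` of a submanifold `S` of a vector space `V`, as a subset of `T_x V`: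
the velocities at time `0` of the smooth curves in `V` that run inside `S` and start at `x`. -/
def submanifoldTangentSpace (S : Set V) (x : V) : Set (TangentSpace 𝓘(ℝ, V) x) :=
  {v | ∃ γ : ℝ → V, ContDiff ℝ ∞ γ ∧ (∀ t, γ t ∈ S) ∧ γ 0 = x ∧
    HasDerivAt γ (NormedSpace.fromTangentSpace (𝕜 := ℝ) x v) 0}

/-- Euclidean parallel translation `T_a V → T_b V`. -/
def euclideanParallelTransport (a b : V) :
    TangentSpace 𝓘(ℝ, V) a →L[ℝ] TangentSpace 𝓘(ℝ, V) b :=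
  ((NormedSpace.fromTangentSpace (𝕜 := ℝ) b).symm : V →L[ℝ] TangentSpace 𝓘(ℝ, V) b).comp
    (NormedSpace.fromTangentSpace (𝕜 := ℝ) a : TangentSpace 𝓘(ℝ, V) a →L[ℝ] V)

/-- The natural identification of a subspace of `V` with a subspace of `T_0 V`. -/
def Submodule.atZero (W : Submodule ℝ V) : Submodule ℝ (TangentSpace 𝓘(ℝ, V) (0 : V)) :=
  W.comap (NormedSpace.fromTangentSpace (𝕜 := ℝ) (0 : V)).toLinearMap

end Euclidean

/-- `P` is a set of positive elements of the (reduced or non-reduced) root system `Φ`. -/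
structure IsPositiveSystem {V : Type*} [AddCommGroup V] (Φ P : Set V) : Prop where
  subset : P ⊆ Φ
  pos_or_neg : ∀ α ∈ Φ, Xor (α ∈ P) (-α ∈ P)
  add_mem : ∀ α ∈ P, ∀ β ∈ P, α + β ∈ Φ → α + β ∈ P

section Group

variable {n : ℕ} {G : Type*} [TopologicalSpace G] [Group G]
  [ChartedSpace (EuclideanSpace ℝ (Fin n)) G]

/-- The differential at the identity of a group homomorphism `f : G → G`, as a linear
endomorphism of the Lie algebra of `G` (recall that `f 1 = 1`). -/
def lieDifferential (f : G →* G) :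
    GroupLieAlgebra (𝓡 n) G →ₗ[ℝ] GroupLieAlgebra (𝓡 n) G :=
  (mfderiv (𝓡 n) (𝓡 n) f 1 : EuclideanSpace ℝ (Fin n) →L[ℝ] EuclideanSpace ℝ (Fin n)).toLinearMap

/-- The adjoint representation: `Ad g` is the differential at `1` of `h ↦ g h g⁻¹`. -/
def lieAd (g : G) : GroupLieAlgebra (𝓡 n) G →ₗ[ℝ] GroupLieAlgebra (𝓡 n) G :=
  lieDifferential (MulAut.conj g).toMonoidHom

variable [LieGroup (𝓡 n) ∞ G]

variable (n G) in
/-- A Riemannian symmetric pair `(G, K)` of compact type, with its involution `σ`. -/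
structure CompactSymmetricPair where
  /-- the involution of `G` -/
  σ : G →* G
  /-- the isotropy group -/
  K : Subgroup G
  σ_smooth : ContMDiff (𝓡 n) (𝓡 n) ∞ σ
  σ_involutive : ∀ g, σ (σ g) = g
  K_closed : IsClosed (K : Set G)
  /-- `K` is contained in the group of fixed points of `σ`. -/
  σ_fixes_K : ∀ k ∈ K, σ k = k
  /-- `K` contains the identity component of the group of fixed points of `σ`. -/
  fixed_component_le : connectedComponentIn {g : G | σ g = g} 1 ⊆ K
  /-- Compact type: the Killing form of the Lie algebra of `G` is negative definite. -/
  killing_neg : ∀ X : GroupLieAlgebra (𝓡 n) G, X ≠ 0 →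
    killingForm ℝ (GroupLieAlgebra (𝓡 n) G) X X < 0

namespace CompactSymmetricPair

variable (S : CompactSymmetricPair n G)

/-- The `-1` eigenspace `𝔭` of the involution `dσ`, as a subspace of the Lie algebra. -/
def pSubmodule : Submodule ℝ (GroupLieAlgebra (𝓡 n) G) :=
  Module.End.eigenspace (lieDifferential S.σ) (-1)

/-- The vector space `𝔭`, as a type of its own. It carries the Euclidean structure given by minus
the Killing form. -/
def P : Type := ↥S.pSubmodule

instance : AddCommGroup S.P := inferInstanceAs (AddCommGroup S.pSubmodule)

instance : Module ℝ S.P := inferInstanceAs (Module ℝ S.pSubmodule)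

/-- The inclusion of `𝔭` into the Lie algebra `𝔤`. -/
def incl : S.P →ₗ[ℝ] GroupLieAlgebra (𝓡 n) G := S.pSubmodule.subtype

theorem incl_injective : Function.Injective S.incl := Subtype.val_injective

/-- Minus the Killing form is an inner product on `𝔭`. -/
@[reducible] def innerCore : InnerProductSpace.Core ℝ S.P where
  inner X Y := -killingForm ℝ (GroupLieAlgebra (𝓡 n) G) (S.incl X) (S.incl Y)
  conj_inner_symm X Y := by
    change -_ = -_
    rw [LieModule.traceForm_comm]
  re_inner_nonneg X := by
    change 0 ≤ -_
    by_cases h : S.incl X = 0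
    · simp [h]
    · have := S.killing_neg _ h
      linarith
  add_left X Y Z := by
    simp only [map_add, LinearMap.add_apply]
    ring
  smul_left X Y r := by
    simp
  definite X h := by
    by_contra hX
    have h1 : S.incl X ≠ 0 := fun h0 => hX (S.incl_injective (by rw [h0, map_zero]))
    have h2 := S.killing_neg _ h1
    have h3 : -killingForm ℝ (GroupLieAlgebra (𝓡 n) G) (S.incl X) (S.incl X) = 0 := h
    linarith

instance : NormedAddCommGroup S.P := S.innerCore.toNormedAddCommGroup

instance : InnerProductSpace ℝ S.P := InnerProductSpace.ofCore S.innerCore.toCore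

/-- The orbit `Ad(K) x ⊆ 𝔭` (the maps `Ad k`, `k ∈ K`, commute with `dσ` and preserve `𝔭`). -/
def adOrbit (x : S.P) : Set S.P := {y | ∃ k ∈ S.K, S.incl y = lieAd k (S.incl x)}

/-- `𝔥` is a maximal abelian subspace of `𝔭`. -/
def IsMaximalAbelian (𝔥 : Submodule ℝ (GroupLieAlgebra (𝓡 n) G)) : Prop :=
  Maximal (fun 𝔟 : Submodule ℝ (GroupLieAlgebra (𝓡 n) G) =>
    𝔟 ≤ S.pSubmodule ∧ ∀ X ∈ 𝔟, ∀ Y ∈ 𝔟, ⁅X, Y⁆ = 0) 𝔥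

end CompactSymmetricPair

/-- `𝔤(α) = {X ∈ 𝔤 | [H, [H, X]] = -α(H)² X for all H ∈ 𝔥}`. -/
def rootSpaceG (𝔥 : Submodule ℝ (GroupLieAlgebra (𝓡 n) G)) (α : Module.Dual ℝ 𝔥) :
    Submodule ℝ (GroupLieAlgebra (𝓡 n) G) where
  carrier := {X | ∀ H : 𝔥, ⁅(H : GroupLieAlgebra (𝓡 n) G), ⁅(H : GroupLieAlgebra (𝓡 n) G), X⁆⁆ =
    (-((α H) ^ 2)) • X}
  add_mem' hX hY H := by rw [lie_add, lie_add, hX H, hY H, smul_add]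
  zero_mem' H := by rw [lie_zero, lie_zero, smul_zero]
  smul_mem' c X hX H := by rw [lie_smul, lie_smul, hX H, smul_comm]

/-- The restricted roots: the nonzero `α ∈ 𝔥*` with `𝔤(α) ≠ 0`. -/
def restrictedRoots (𝔥 : Submodule ℝ (GroupLieAlgebra (𝓡 n) G)) : Set (Module.Dual ℝ 𝔥) :=
  {α | α ≠ 0 ∧ rootSpaceG 𝔥 α ≠ ⊥}

/-- `𝔭(α) = 𝔤(α) ∩ 𝔭`, as a subspace of `𝔭`. -/
def CompactSymmetricPair.rootSpaceP (S : CompactSymmetricPair n G)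
    (𝔥 : Submodule ℝ (GroupLieAlgebra (𝓡 n) G)) (α : Module.Dual ℝ 𝔥) : Submodule ℝ S.P :=
  (rootSpaceG 𝔥 α).comap S.incl

end Group

end

/-! Write `B` for the Killing form and `θ = dσ`. Since `B` is negative definite and invariant, each
`ad H` is skew for `-B`, so for `H` in an abelian `𝔥` the operators `(ad H)²` are commuting and
symmetric, and `𝔤` is the direct sum of their joint eigenspaces (`jointSpace_decomposition`). Each
nonzero joint eigenspace has eigenvalues `-α(H)²` with `α` linear (`exists_dual_of_mem_jointSpace`)
and unique up to sign. Distinct positive roots thus give distinct eigenvalue systems, which makes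
the sum direct. As `θ` preserves each joint eigenspace, `𝔭` is spanned by the `𝔭(α)` with `α`
positive and `α(x) ≠ 0`, together with the centralizer of `x` in `𝔭`
(`neg_eigenspace_le_iSup_sup_centralizer`).

Root vectors are velocities: for `X ∈ 𝔭(α)` with `α(x) ≠ 0`, the vector `Z = α(x)⁻²[x, X]` is fixed
by `θ` and `[Z, x] = X`. The integral curve `c` of the left invariant field of `Z` stays in `K` for
small time, and `Ad(c(t))x` has velocity `[Z, x]` (`exists_orbit_curve`). This needs that the
derivative of `Ad` at `1` is `ad`, which is computed in the chart at `1`.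

Conversely, decompose a velocity of the orbit as `[Z, x] + Y` with `[x, Y] = 0`. Along the curve all
`ad γ(t)` are conjugate to `ad x`, so its minimal polynomial `q` annihilates them all.
Differentiating `q(ad γ(t)) = 0` leaves `q'(ad x) ad Y = 0`. Since `ad x` is semisimple, `q` is
squarefree and `q'(ad x)` is invertible, so `ad Y = 0` and hence `Y = 0`
(`ad_eq_zero_of_hasDerivAt_orbit`). No manifold structure on the orbit is needed. -/

noncomputable section

/-! ### Real Lie algebras with negative definite Killing form -/

section CompactLieAlgebra

variable {L : Type*} [LieRing L] [LieAlgebra ℝ L]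

/-- Minus the Killing form is an inner product if the Killing form is negative definite. -/
@[reducible] def negKillingCore (hK : ∀ X : L, X ≠ 0 → killingForm ℝ L X X < 0) :
    InnerProductSpace.Core ℝ L where
  inner X Y := -killingForm ℝ L X Y
  conj_inner_symm X Y := by
    change -_ = -_
    rw [LieModule.traceForm_comm]
  re_inner_nonneg X := by
    change 0 ≤ -_
    by_cases h : X = 0
    · simp [h]
    · have := hK _ h
      linarith
  add_left X Y Z := by
    simp only [map_add, LinearMap.add_apply]
    ring
  smul_left X Y r := by simp
  definite X h := by
    by_contra hX
    have h2 := hK _ hX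
    have h3 : -killingForm ℝ L X X = 0 := h
    linarith

/-- `ad x` is skew for the inner product `-B`, so the orthogonal complement of an invariant subspace
is an invariant complement. -/
theorem isSemisimple_ad_of_killingForm_neg [Module.Finite ℝ L]
    (hK : ∀ X : L, X ≠ 0 → killingForm ℝ L X X < 0) (x : L) :
    (LieAlgebra.ad ℝ L x : Module.End ℝ L).IsSemisimple := by
  let _ : NormedAddCommGroup L := (negKillingCore hK).toNormedAddCommGroup
  let _ : InnerProductSpace ℝ L := InnerProductSpace.ofCore (negKillingCore hK).toCore
  refine Module.End.isSemisimple_iff.2 fun p hp => ⟨pᗮ, ?_, ?_⟩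
  · intro y hy z hz
    have h1 : inner ℝ ⁅x, z⁆ y = 0 := hy _ (hp hz)
    have h2 : inner ℝ ⁅x, z⁆ y = -inner ℝ z ⁅x, y⁆ := by
      change -killingForm ℝ L ⁅x, z⁆ y = -(-killingForm ℝ L z ⁅x, y⁆)
      rw [killingForm, LieModule.traceForm_apply_lie_apply' ℝ L L x z y]
    have h3 : inner ℝ z ⁅x, y⁆ = 0 := by linarith
    exact h3
  · exact Submodule.isCompl_orthogonal p

/-- By invariance `B([x,y],[x,y]) = -B(y,[x,[x,y]])`, and `B` is definite. -/
theorem lie_eq_zero_of_lie_lie_eq_zero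
    (hK : ∀ X : L, X ≠ 0 → killingForm ℝ L X X < 0) {x y : L} (h : ⁅x, ⁅x, y⁆⁆ = 0) :
    ⁅x, y⁆ = 0 := by
  by_contra hne
  have h1 := hK _ hne
  have h2 := LieModule.traceForm_apply_lie_apply' ℝ L L x y ⁅x, y⁆
  rw [h, map_zero, neg_zero] at h2
  exact h1.ne h2

theorem eq_zero_of_ad_eq_zero
    (hK : ∀ X : L, X ≠ 0 → killingForm ℝ L X X < 0) {y : L} (h : LieAlgebra.ad ℝ L y = 0) :
    y = 0 := by
  by_contra hne
  have h1 := hK _ hne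
  rw [LieModule.traceForm_apply_apply] at h1
  change LinearMap.trace ℝ L (LieAlgebra.ad ℝ L y ∘ₗ LieAlgebra.ad ℝ L y) < 0 at h1
  rw [h] at h1
  simp at h1

/-- The operators `(ad H)²`, for `H` in a subspace `𝔥`. -/
def adSq (𝔥 : Submodule ℝ L) (H : 𝔥) : Module.End ℝ L :=
  LieAlgebra.ad ℝ L (H : L) ∘ₗ LieAlgebra.ad ℝ L (H : L)

theorem adSq_apply (𝔥 : Submodule ℝ L) (H : 𝔥) (X : L) :
    adSq 𝔥 H X = ⁅(H : L), ⁅(H : L), X⁆⁆ := rfl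

/-- The joint eigenspace of the operators `(ad H)²` with eigenvalues `χ H`. -/
def jointSpace (𝔥 : Submodule ℝ L) (χ : 𝔥 → ℝ) : Submodule ℝ L :=
  ⨅ H, Module.End.eigenspace (adSq 𝔥 H) (χ H)

theorem mem_jointSpace {𝔥 : Submodule ℝ L} {χ : 𝔥 → ℝ} {X : L} :
    X ∈ jointSpace 𝔥 χ ↔ ∀ H : 𝔥, ⁅(H : L), ⁅(H : L), X⁆⁆ = χ H • X := by
  simp only [jointSpace, Submodule.mem_iInf, Module.End.mem_eigenspace_iff, adSq_apply]

theorem lie_comm_of_abelian {𝔥 : Submodule ℝ L} (hab : ∀ X ∈ 𝔥, ∀ Y ∈ 𝔥, ⁅X, Y⁆ = 0)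
    {H H' : L} (hH : H ∈ 𝔥) (hH' : H' ∈ 𝔥) (X : L) : ⁅H, ⁅H', X⁆⁆ = ⁅H', ⁅H, X⁆⁆ := by
  rw [leibniz_lie, hab _ hH _ hH', zero_lie, zero_add]

/-- Simultaneous diagonalization of commuting symmetric operators. The index `χ` runs over arbitrary
functions; that only squares of linear forms contribute is shown separately. -/
theorem jointSpace_decomposition [Module.Finite ℝ L]
    (hK : ∀ X : L, X ≠ 0 → killingForm ℝ L X X < 0)
    {𝔥 : Submodule ℝ L} (hab : ∀ X ∈ 𝔥, ∀ Y ∈ 𝔥, ⁅X, Y⁆ = 0) :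
    iSupIndep (jointSpace 𝔥) ∧ ⨆ χ, jointSpace 𝔥 χ = ⊤ := by
  let _ : NormedAddCommGroup L := (negKillingCore hK).toNormedAddCommGroup
  let _ : InnerProductSpace ℝ L := InnerProductSpace.ofCore (negKillingCore hK).toCore
  have hsymm : ∀ H, (adSq 𝔥 H).IsSymmetric := by
    intro H X Y
    change -killingForm ℝ L ⁅(H : L), ⁅(H : L), X⁆⁆ Y = -killingForm ℝ L X ⁅(H : L), ⁅(H : L), Y⁆⁆
    rw [killingForm, LieModule.traceForm_apply_lie_apply' ℝ L L,
      LieModule.traceForm_apply_lie_apply' ℝ L L, neg_neg]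
  have hcomm : Pairwise (Function.onFun Commute (adSq 𝔥)) := by
    intro H H' _
    change adSq 𝔥 H * adSq 𝔥 H' = adSq 𝔥 H' * adSq 𝔥 H
    ext X
    simp only [Module.End.mul_apply, adSq_apply]
    rw [lie_comm_of_abelian hab H.2 H'.2, lie_comm_of_abelian hab H.2 H'.2,
      lie_comm_of_abelian hab H.2 H'.2, lie_comm_of_abelian hab H.2 H'.2]
  exact ⟨(LinearMap.IsSymmetric.orthogonalFamily_iInf_eigenspaces hsymm).independent,
    LinearMap.IsSymmetric.iSup_iInf_eq_top_of_commute hsymm hcomm⟩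

/-- The eigenvalues of `(ad H)²` are minus the squares of a linear form. -/
theorem exists_dual_of_mem_jointSpace (hK : ∀ X : L, X ≠ 0 → killingForm ℝ L X X < 0)
    {𝔥 : Submodule ℝ L} (hab : ∀ X ∈ 𝔥, ∀ Y ∈ 𝔥, ⁅X, Y⁆ = 0) {χ : 𝔥 → ℝ} {X : L}
    (hX : X ∈ jointSpace 𝔥 χ) (hX0 : X ≠ 0) :
    ∃ α : Module.Dual ℝ 𝔥, ∀ H, χ H = -(α H) ^ 2 := by
  rw [mem_jointSpace] at hX
  by_cases hχ : ∀ H, χ H = 0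
  · exact ⟨0, fun H => by simp [hχ H]⟩
  push Not at hχ
  obtain ⟨H₀, hH₀⟩ := hχ
  set Y : L := ⁅(H₀ : L), X⁆ with hY
  have hY0 : Y ≠ 0 := by
    intro h
    have := hX H₀
    rw [← hY, h, lie_zero] at this
    exact (smul_ne_zero hH₀ hX0) this.symm
  have hYK := hK Y hY0
  have hneg : 0 < -χ H₀ := by
    have h1 := LieModule.traceForm_apply_lie_apply' ℝ L L (H₀ : L) X Y
    rw [hX H₀, map_smul, smul_eq_mul] at h1
    have h2 : killingForm ℝ L Y Y = -(χ H₀ * killingForm ℝ L X X) := h1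
    have h3 := hK X hX0
    by_contra hcon
    nlinarith
  -- Polarizing `(ad (H + H₀))²` shows that `ad H ad H₀` acts on `X` by a scalar; applying `ad H₀`
  -- once more and dividing by `χ H₀` puts every `[H, X]` on the line of `Y`.
  have hspan : ∀ H : 𝔥, ∃ c : ℝ, ⁅(H : L), X⁆ = c • Y := by
    intro H
    have hpol : (2 : ℝ) • ⁅(H : L), Y⁆ = (χ (H + H₀) - χ H - χ H₀) • X := by
      have h1 := hX (H + H₀)
      simp only [Submodule.coe_add, add_lie, lie_add] at h1
      rw [lie_comm_of_abelian hab H₀.2 H.2, hX H, hX H₀] at h1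
      rw [sub_smul, sub_smul, ← h1, two_smul]
      abel
    refine ⟨(χ (H + H₀) - χ H - χ H₀) / 2 / χ H₀, ?_⟩
    have h2 : χ H₀ • ⁅(H : L), X⁆ = ((χ (H + H₀) - χ H - χ H₀) / 2) • Y := by
      rw [← lie_smul, ← hX H₀, lie_comm_of_abelian hab H.2 H₀.2]
      have h3 : ⁅(H : L), Y⁆ = ((χ (H + H₀) - χ H - χ H₀) / 2) • X := by
        rw [div_eq_inv_mul, mul_smul, ← hpol, smul_smul]
        norm_num
      rw [h3, lie_smul]
    rw [div_eq_inv_mul _ (χ H₀), mul_smul, ← h2, smul_smul, inv_mul_cancel₀ hH₀, one_smul]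
  -- If `[H, X] = c(H) Y`, then `c(H) = B(Y,[H,X]) / B(Y,Y)` is visibly linear in `H` and `χ H =
  -- c(H)² χ H₀`; the square root absorbs `-χ H₀ > 0`.
  let α : Module.Dual ℝ 𝔥 :=
    (Real.sqrt (-χ H₀) / killingForm ℝ L Y Y) • ((killingForm ℝ L Y) ∘ₗ
      ((LieModule.toEnd ℝ L L : L →ₗ[ℝ] Module.End ℝ L).flip X) ∘ₗ 𝔥.subtype)
  refine ⟨α, fun H => ?_⟩
  obtain ⟨c, hc⟩ := hspan H
  have hα : α H = Real.sqrt (-χ H₀) * c := by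
    change Real.sqrt (-χ H₀) / killingForm ℝ L Y Y * killingForm ℝ L Y ⁅(H : L), X⁆ = _
    rw [hc, map_smul, smul_eq_mul]
    field_simp [hYK.ne]
  have h4 : χ H • X = (c * c * χ H₀) • X := by
    rw [← hX H, hc, lie_smul, hY, lie_comm_of_abelian hab H.2 H₀.2, hc, lie_smul, hY, hX H₀,
      smul_smul, smul_smul, mul_assoc]
  have h5 := smul_left_injective ℝ hX0 h4
  rw [hα, mul_pow, Real.sq_sqrt hneg.le, h5]
  ring

/-- A vector space is not the union of two proper subspaces, here the kernels of `α - β` and `α +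
β`: the sum of a vector outside each lies outside both. -/
theorem dual_eq_or_eq_neg_of_sq_eq {V : Type*} [AddCommGroup V] [Module ℝ V]
    {α β : Module.Dual ℝ V} (h : ∀ H, (α H) ^ 2 = (β H) ^ 2) : α = β ∨ α = -β := by
  by_contra! hcon
  obtain ⟨h1, h2⟩ := hcon
  obtain ⟨u, hu⟩ : ∃ u, α u - β u ≠ 0 := by
    by_contra! hc
    exact h1 (LinearMap.ext fun u => sub_eq_zero.1 (hc u))
  obtain ⟨w, hw⟩ : ∃ w, α w + β w ≠ 0 := by
    by_contra! hc
    exact h2 (LinearMap.ext fun u => eq_neg_of_add_eq_zero_left (hc u))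
  have hu' : α u + β u = 0 := (mul_eq_zero.1 (by linear_combination h u :
    (α u - β u) * (α u + β u) = 0)).resolve_left hu
  have hw' : α w - β w = 0 := (mul_eq_zero.1 (by linear_combination h w :
    (α w - β w) * (α w + β w) = 0)).resolve_right hw
  have h3 := h (u + w)
  simp only [map_add] at h3
  refine mul_ne_zero hu hw ?_
  linear_combination h3 - (α w + β w) * hw' - (α u - β u + (α w - β w)) * hu'

variable {𝔥 : Submodule ℝ L}

/-- The characters of distinct positive roots are distinct. -/
theorem IsPositiveSystem.sq_injOn {V : Type*} [AddCommGroup V] [Module ℝ V]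
    {Φ P : Set (Module.Dual ℝ V)} (hP : IsPositiveSystem Φ P)
    {α β : Module.Dual ℝ V} (hα : α ∈ P) (hβ : β ∈ P)
    (h : ∀ H, (α H) ^ 2 = (β H) ^ 2) : α = β := by
  rcases dual_eq_or_eq_neg_of_sq_eq h with h | h
  · exact h
  · rcases hP.pos_or_neg β (hP.subset hβ) with h1 | h1
    · exact absurd (h ▸ hα) h1.2
    · exact absurd hβ h1.2

/-- A `-1` eigenspace of an involution is the sum of its components in the centralizer of `x` and
in the root spaces of the positive roots not vanishing at `x`. -/
theorem neg_eigenspace_le_iSup_sup_centralizer [Module.Finite ℝ L]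
    (hK : ∀ X : L, X ≠ 0 → killingForm ℝ L X X < 0)
    (hab : ∀ X ∈ 𝔥, ∀ Y ∈ 𝔥, ⁅X, Y⁆ = 0)
    {θ : L →ₗ[ℝ] L} (hθ : ∀ X Y, θ ⁅X, Y⁆ = ⁅θ X, θ Y⁆) (hθ2 : ∀ X, θ (θ X) = X)
    (h𝔭 : 𝔥 ≤ Module.End.eigenspace θ (-1))
    {Φ P : Set (Module.Dual ℝ 𝔥)} (hP : IsPositiveSystem Φ P)
    (hΦ : ∀ α : Module.Dual ℝ 𝔥, α ≠ 0 → jointSpace 𝔥 (fun H => -(α H) ^ 2) ≠ ⊥ → α ∈ Φ)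
    (x : 𝔥) :
    Module.End.eigenspace θ (-1) ≤
      (⨆ α : {α : Module.Dual ℝ 𝔥 // α ∈ P ∧ α x ≠ 0},
        jointSpace 𝔥 (fun H => -(α.1 H) ^ 2) ⊓ Module.End.eigenspace θ (-1)) ⊔
      (LinearMap.ker (LieAlgebra.ad ℝ L (x : L)) ⊓ Module.End.eigenspace θ (-1)) := by
  have hθh : ∀ H ∈ 𝔥, θ H = -H := fun H hH => by
    have := Module.End.mem_eigenspace_iff.1 (h𝔭 hH)
    simpa using this
  -- `θ` is `-1` on `𝔥`, and the two signs cancel in `(ad H)²`, so `θ` preserves every joint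
  -- eigenspace.
  have hproj : ∀ χ : 𝔥 → ℝ, ∀ X ∈ jointSpace 𝔥 χ,
      X - θ X ∈ jointSpace 𝔥 χ ⊓ Module.End.eigenspace θ (-1) := by
    intro χ X hX
    refine ⟨Submodule.sub_mem _ hX ?_, ?_⟩
    · rw [mem_jointSpace] at hX ⊢
      intro H
      have := congrArg θ (hX H)
      rwa [hθ, hθ, hθh _ H.2, neg_lie, neg_lie, lie_neg, neg_neg, map_smul] at this
    · refine Module.End.mem_eigenspace_iff.2 ?_
      rw [map_sub, hθ2]
      simp
  intro X hX
  have hX' : θ X = -X := by simpa using Module.End.mem_eigenspace_iff.1 hX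
  set W := (⨆ α : {α : Module.Dual ℝ 𝔥 // α ∈ P ∧ α x ≠ 0},
        jointSpace 𝔥 (fun H => -(α.1 H) ^ 2) ⊓ Module.End.eigenspace θ (-1)) ⊔
      (LinearMap.ker (LieAlgebra.ad ℝ L (x : L)) ⊓ Module.End.eigenspace θ (-1)) with hW
  -- Twice the projection to the `-1` eigenspace is tested on each joint eigenspace; on the given
  -- `X` it is multiplication by `2`.
  have hmap : (⊤ : Submodule ℝ L) ≤ W.comap (LinearMap.id - θ) := by
    rw [← (jointSpace_decomposition hK hab).2]
    refine iSup_le fun χ Z hZ => ?_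
    have hZ' := hproj χ Z hZ
    change Z - θ Z ∈ W
    by_cases hZ0 : Z - θ Z = 0
    · rw [hZ0]
      exact zero_mem _
    obtain ⟨α, hα⟩ := exists_dual_of_mem_jointSpace hK hab hZ'.1 hZ0
    obtain rfl : χ = fun H => -(α H) ^ 2 := funext hα
    by_cases hαx : α x = 0
    · refine Submodule.mem_sup_right ⟨?_, hZ'.2⟩
      have := mem_jointSpace.1 hZ'.1 x
      rw [hαx, zero_pow two_ne_zero, neg_zero, zero_smul] at this
      exact lie_eq_zero_of_lie_lie_eq_zero hK this
    · refine Submodule.mem_sup_left ?_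
      have hα0 : α ≠ 0 := by
        rintro rfl
        exact hαx rfl
      have hαΦ : α ∈ Φ := hΦ α hα0 fun hbot => hZ0 (by simpa [hbot] using hZ'.1)
      rcases hP.pos_or_neg α hαΦ with h | h
      · exact Submodule.mem_iSup_of_mem ⟨α, h.1, hαx⟩ hZ'
      · refine Submodule.mem_iSup_of_mem ⟨-α, h.1, by simpa using hαx⟩ ?_
        simpa using hZ'
  have h2 : X - θ X ∈ W := hmap trivial
  have h3 : X = (2⁻¹ : ℝ) • (X - θ X) := by
    rw [hX', sub_neg_eq_add, ← two_smul ℝ X, smul_smul]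
    norm_num
  rw [h3]
  exact W.smul_mem _ h2

end CompactLieAlgebra

/-! ### Isospectral curves -/

section Isospectral

variable {𝔸 : Type*} [NormedRing 𝔸] [NormedAlgebra ℝ 𝔸]

/-- The derivative of a polynomial in `A` along `[B, A] + C`, where `C` commutes with `A`. -/
theorem hasDerivAt_aeval_of_commute {A : ℝ → 𝔸} {t : ℝ} {B C : 𝔸} (hC : Commute (A t) C)
    (hA : HasDerivAt A (B * A t - A t * B + C) t) (q : Polynomial ℝ) :
    HasDerivAt (fun s => Polynomial.aeval (A s) q)
      (B * Polynomial.aeval (A t) q - Polynomial.aeval (A t) q * B +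
        Polynomial.aeval (A t) (Polynomial.derivative q) * C) t := by
  have hpow : ∀ n : ℕ, HasDerivAt (fun s => A s ^ n)
      (B * A t ^ n - A t ^ n * B + (n : ℝ) • (A t ^ (n - 1) * C)) t := by
    intro n
    induction n with
    | zero => simpa using hasDerivAt_const t (1 : 𝔸)
    | succ n ih =>
      have h := ih.mul hA
      simp only [pow_succ]
      refine h.congr_deriv ?_
      -- For `n = 0` the truncated exponent is harmless because the coefficient vanishes.
      have h1 : (n : ℝ) • (A t ^ (n - 1) * C) * A t = (n : ℝ) • (A t ^ n * C) := by
        cases n with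
        | zero => simp
        | succ m =>
          rw [smul_mul_assoc, mul_assoc, ← hC.eq, ← mul_assoc, Nat.add_sub_cancel, pow_succ]
      rw [add_mul, h1, Nat.add_sub_cancel, Nat.cast_succ, add_smul, one_smul]
      noncomm_ring
  induction q using Polynomial.induction_on' with
  | add p q hp hq =>
    simp only [map_add]
    refine (hp.add hq).congr_deriv ?_
    noncomm_ring
  | monomial n a =>
    simp only [Polynomial.aeval_monomial, Polynomial.derivative_monomial,
      ← Algebra.smul_def]
    refine ((hpow n).const_smul a).congr_deriv ?_
    rw [smul_add, smul_sub, mul_smul_comm, smul_mul_assoc, smul_smul, smul_mul_assoc]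

/-- If a squarefree polynomial annihilates a curve, then its velocity has no component commuting
with it. -/
theorem eq_zero_of_aeval_eq_zero_of_commute {A : ℝ → 𝔸} {t : ℝ} {B C : 𝔸}
    (hC : Commute (A t) C) (hA : HasDerivAt A (B * A t - A t * B + C) t) {q : Polynomial ℝ}
    (hq : Squarefree q) (hq0 : ∀ s, Polynomial.aeval (A s) q = 0) : C = 0 := by
  have h := hasDerivAt_aeval_of_commute hC hA q
  simp only [hq0] at h
  have h1 := h.unique (hasDerivAt_const t (0 : 𝔸))
  simp only [mul_zero, zero_mul, sub_zero, zero_add] at h1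
  -- Evaluating the Bézout identity `u q + w q' = 1` at `A t` makes `w(A t)` a left inverse of `q'(A
  -- t)`, which kills `C`.
  obtain ⟨u, w, huw⟩ := (PerfectField.separable_iff_squarefree.2 hq)
  have h2 := congrArg (Polynomial.aeval (A t)) huw
  simp only [map_add, map_mul, hq0, mul_zero, zero_add, map_one] at h2
  rw [← one_mul C, ← h2, mul_assoc, h1, mul_zero]

end Isospectral

/-- A curve in the adjoint orbit of a semisimple element `x` of a Lie algebra has, at `x`, no
velocity component centralizing `x`. -/
theorem ad_eq_zero_of_hasDerivAt_orbit {L : Type*} [LieRing L] [LieAlgebra ℝ L] [Module.Finite ℝ L]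
    {V : Type*} [NormedAddCommGroup V] [NormedSpace ℝ V] [FiniteDimensional ℝ V]
    (ι : V →ₗ[ℝ] L) {γ : ℝ → V} {v : V} {x : V} (hγ0 : γ 0 = x) (hγ : HasDerivAt γ v 0)
    (hx : (LieAlgebra.ad ℝ L (ι x) : Module.End ℝ L).IsSemisimple)
    (horb : ∀ t, ∃ φ : L ≃ₗ⁅ℝ⁆ L, ι (γ t) = φ (ι x))
    {Z Y : L} (hv : ι v = ⁅Z, ι x⁆ + Y) (hY : ⁅ι x, Y⁆ = 0) :
    LieAlgebra.ad ℝ L Y = 0 := by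
  classical
  -- `L` carries no norm; matrices in a basis provide a normed algebra in which to differentiate.
  let b := Module.finBasis ℝ L
  let M := Matrix (Fin (Module.finrank ℝ L)) (Fin (Module.finrank ℝ L)) ℝ
  let _ : NormedRing M := Matrix.linftyOpNormedRing
  let _ : NormedAlgebra ℝ M := Matrix.linftyOpNormedAlgebra
  let e : Module.End ℝ L ≃ₐ[ℝ] M := LinearMap.toMatrixAlgEquiv b
  let T : V →ₗ[ℝ] M := e.toLinearMap ∘ₗ (LieAlgebra.ad ℝ L : L →ₗ[ℝ] Module.End ℝ L) ∘ₗ ι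
  have hT : ∀ y, T y = e (LieAlgebra.ad ℝ L (ι y)) := fun _ => rfl
  have hder : HasDerivAt (fun t => T (γ t)) (T v) 0 :=
    (LinearMap.toContinuousLinearMap T).hasFDerivAt.comp_hasDerivAt 0 hγ
  have hTv : T v = e (LieAlgebra.ad ℝ L Z) * T (γ 0) - T (γ 0) * e (LieAlgebra.ad ℝ L Z) +
      e (LieAlgebra.ad ℝ L Y) := by
    rw [hT, hT, hγ0, hv, ← map_mul e, ← map_mul e, ← map_sub e, ← map_add e]
    congr 1
    ext W
    simp
  have hcomm : Commute (T (γ 0)) (e (LieAlgebra.ad ℝ L Y)) := by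
    rw [hT, hγ0]
    have h2 : LieAlgebra.ad ℝ L (ι x) * LieAlgebra.ad ℝ L Y =
        LieAlgebra.ad ℝ L Y * LieAlgebra.ad ℝ L (ι x) := by
      ext W
      simp only [Module.End.mul_apply, LieAlgebra.ad_apply]
      rw [leibniz_lie, hY, zero_lie, zero_add]
    exact Commute.map h2 e
  rw [hTv] at hder
  have h0 := eq_zero_of_aeval_eq_zero_of_commute (A := fun t => T (γ t)) hcomm hder
    hx.minpoly_squarefree (fun s => by
      obtain ⟨φ, hφ⟩ := horb s
      change Polynomial.aeval (e (LieAlgebra.ad ℝ L (ι (γ s)))) _ = 0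
      rw [hφ, ← LieAlgebra.conj_ad_apply]
      have h3 : φ.toLinearEquiv.conj (LieAlgebra.ad ℝ L (ι x)) =
          φ.toLinearEquiv.conjAlgEquiv ℝ (LieAlgebra.ad ℝ L (ι x)) := rfl
      rw [h3]
      change Polynomial.aeval ((e : Module.End ℝ L →ₐ[ℝ] M)
        ((φ.toLinearEquiv.conjAlgEquiv ℝ : Module.End ℝ L →ₐ[ℝ] Module.End ℝ L) _)) _ = 0
      rw [Polynomial.aeval_algHom_apply, Polynomial.aeval_algHom_apply, minpoly.aeval, map_zero,
        map_zero])
  exact (map_eq_zero_iff e e.injective).1 h0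

/-! ### The derivative of the adjoint representation in a chart -/

section LocalGroup

variable {E : Type*} [NormedAddCommGroup E] [NormedSpace ℝ E]

theorem fderiv_partial_snd {m : E × E → E} {x y : E} (hm : DifferentiableAt ℝ m (x, y)) :
    fderiv ℝ (fun z => m (x, z)) y = (fderiv ℝ m (x, y)).comp (.inr ℝ E E) :=
  (HasFDerivAt.comp y (f := fun z : E => (x, z)) hm.hasFDerivAt
    (hasFDerivAt_prodMk_right x y)).fderiv

theorem fderiv_partial_fst {m : E × E → E} {x y : E} (hm : DifferentiableAt ℝ m (x, y)) :
    fderiv ℝ (fun z => m (z, y)) x = (fderiv ℝ m (x, y)).comp (.inl ℝ E E) :=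
  (HasFDerivAt.comp x (f := fun z : E => (z, y)) hm.hasFDerivAt
    (hasFDerivAt_prodMk_left x y)).fderiv

theorem ContDiffAt.eventually_differentiableAt_of_two {F : Type*} [NormedAddCommGroup F]
    [NormedSpace ℝ F] {f : F → E} {p : F} (hf : ContDiffAt ℝ 2 f p) :
    ∀ᶠ q in 𝓝 p, DifferentiableAt ℝ f q :=
  (hf.eventually (by simp)).mono fun _ hq => hq.differentiableAt two_ne_zero

theorem ContDiffAt.differentiableAt_fderiv_of_two {F : Type*} [NormedAddCommGroup F]
    [NormedSpace ℝ F] {f : F → E} {p : F} (hf : ContDiffAt ℝ 2 f p) :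
    DifferentiableAt ℝ (fderiv ℝ f) p :=
  (hf.fderiv_right (m := 1) (by norm_num)).differentiableAt one_ne_zero

/-- The derivative at `a` of `x ↦ ∂₂m(x, a)`. -/
theorem hasFDerivAt_fderiv_partial_snd {m : E × E → E} {a : E} (hm : ContDiffAt ℝ 2 m (a, a)) :
    HasFDerivAt (fun x => fderiv ℝ (fun y => m (x, y)) a)
      (((ContinuousLinearMap.compL ℝ E (E × E) E).flip (.inr ℝ E E)).comp
        ((fderiv ℝ (fderiv ℝ m) (a, a)).comp (.inl ℝ E E))) a := by
  have h1 : (fun x => fderiv ℝ (fun y => m (x, y)) a) =ᶠ[𝓝 a]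
      fun x => (fderiv ℝ m (x, a)).comp (.inr ℝ E E) := by
    have h2 : Filter.Tendsto (fun x : E => (x, a)) (𝓝 a) (𝓝 (a, a)) :=
      (Continuous.prodMk_left a).tendsto a
    filter_upwards [h2.eventually hm.eventually_differentiableAt_of_two] with x hx
    exact fderiv_partial_snd hx
  refine HasFDerivAt.congr_of_eventuallyEq ?_ h1
  exact ((ContinuousLinearMap.compL ℝ E (E × E) E).flip (.inr ℝ E E)).hasFDerivAt.comp a
    (HasFDerivAt.comp a (f := fun x : E => (x, a)) hm.differentiableAt_fderiv_of_two.hasFDerivAt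
      (hasFDerivAt_prodMk_left a a))

/-- For a local group law `m` with unit `a` and conjugation `F`, the derivative of the adjoint
representation is the bracket of the left invariant fields. -/
theorem hasFDerivAt_local_conj {m F : E × E → E} {a : E} (hm : ContDiffAt ℝ 2 m (a, a))
    (hF : ContDiffAt ℝ 2 F (a, a)) (hFa : ∀ᶠ x in 𝓝 a, F (x, a) = a)
    (hm1 : ∀ᶠ y in 𝓝 a, m (a, y) = y) (hm2 : ∀ᶠ x in 𝓝 a, m (x, a) = x)
    (hrel : ∀ᶠ p in 𝓝 (a, a), m (F p, p.1) = m p) :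
    ∃ A' : E →L[ℝ] E →L[ℝ] E,
      HasFDerivAt (fun x => fderiv ℝ (fun y => F (x, y)) a) A' a ∧
      ∀ Z X, A' Z X = VectorField.lieBracket ℝ
        (fun x => fderiv ℝ (fun y => m (x, y)) a Z)
        (fun x => fderiv ℝ (fun y => m (x, y)) a X) a := by
  have hA := hasFDerivAt_fderiv_partial_snd hF
  have hL := hasFDerivAt_fderiv_partial_snd hm
  refine ⟨_, hA, fun Z X => ?_⟩
  set A' := ((ContinuousLinearMap.compL ℝ E (E × E) E).flip (.inr ℝ E E)).comp
        ((fderiv ℝ (fderiv ℝ F) (a, a)).comp (.inl ℝ E E)) with hA'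
  set L' := ((ContinuousLinearMap.compL ℝ E (E × E) E).flip (.inr ℝ E E)).comp
        ((fderiv ℝ (fderiv ℝ m) (a, a)).comp (.inl ℝ E E)) with hL'
  have hmd : DifferentiableAt ℝ m (a, a) := hm.differentiableAt two_ne_zero
  have hR : HasFDerivAt (fun x => (fderiv ℝ m (a, x)).comp (.inl ℝ E E))
      (((ContinuousLinearMap.compL ℝ E (E × E) E).flip (.inl ℝ E E)).comp
        ((fderiv ℝ (fderiv ℝ m) (a, a)).comp (.inr ℝ E E))) a :=
    ((ContinuousLinearMap.compL ℝ E (E × E) E).flip (.inl ℝ E E)).hasFDerivAt.comp a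
      (HasFDerivAt.comp a (f := fun x : E => (a, x)) hm.differentiableAt_fderiv_of_two.hasFDerivAt
        (hasFDerivAt_prodMk_right a a))
  have hLa : fderiv ℝ (fun y => m (a, y)) a = .id ℝ E := by
    rw [Filter.EventuallyEq.fderiv_eq (f₁ := fun y => m (a, y)) (f := id) hm1, fderiv_id]
  have hRa : (fderiv ℝ m (a, a)).comp (.inl ℝ E E) = .id ℝ E := by
    rw [← fderiv_partial_fst hmd,
      Filter.EventuallyEq.fderiv_eq (f₁ := fun y => m (y, a)) (f := id) hm2, fderiv_id]
  have hFa0 : F (a, a) = a := hFa.self_of_nhds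
  -- Differentiate `(x y x⁻¹) x = x y` with respect to `y` at the unit: right translation after `Ad
  -- x` is left translation.
  have hprod : ∀ᶠ x in 𝓝 a, ((fderiv ℝ m (a, x)).comp (.inl ℝ E E)).comp
      (fderiv ℝ (fun y => F (x, y)) a) = fderiv ℝ (fun y => m (x, y)) a := by
    have h2 : Filter.Tendsto (fun x : E => (x, a)) (𝓝 a) (𝓝 (a, a)) :=
      (Continuous.prodMk_left a).tendsto a
    have h3 : Filter.Tendsto (fun x : E => (a, x)) (𝓝 a) (𝓝 (a, a)) :=
      (Continuous.prodMk_right a).tendsto a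
    filter_upwards [h2.eventually hF.eventually_differentiableAt_of_two,
      h3.eventually hm.eventually_differentiableAt_of_two, hFa,
      h2.eventually hrel.eventually_nhds] with x hFx hmx hFax hrelx
    have h4 : (fun y => m (F (x, y), x)) =ᶠ[𝓝 a] fun y => m (x, y) :=
      ((Continuous.prodMk_right x).tendsto a).eventually hrelx
    rw [← h4.fderiv_eq, ← fderiv_partial_fst hmx]
    have hmx' : DifferentiableAt ℝ (fun z => m (z, x)) a :=
      HasFDerivAt.differentiableAt
        (HasFDerivAt.comp a (f := fun z : E => (z, x)) hmx.hasFDerivAt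
          (hasFDerivAt_prodMk_left a x))
    have hFx' : DifferentiableAt ℝ (fun y => F (x, y)) a :=
      HasFDerivAt.differentiableAt
        (HasFDerivAt.comp a (f := fun z : E => (x, z)) hFx.hasFDerivAt
          (hasFDerivAt_prodMk_right x a))
    rw [← hFax] at hmx'
    have h5 := fderiv_comp a hmx' hFx'
    rw [hFax] at h5
    exact h5.symm
  have hAa : fderiv ℝ (fun y => F (a, y)) a = .id ℝ E := by
    have := hprod.self_of_nhds
    rwa [hRa, hLa, ContinuousLinearMap.id_comp] at this
  -- The product rule at `a` expresses `A'` as the mixed second derivative of `m` minus the one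
  -- taken in the other order. Symmetry of the second derivative turns this into `L' Z X - L' X Z`,
  -- the bracket of the two fields.
  have hcomp := (hR.clm_comp hA).congr_of_eventuallyEq
    (Filter.EventuallyEq.symm (f := fun x => ((fderiv ℝ m (a, x)).comp (.inl ℝ E E)).comp
      (fderiv ℝ (fun y => F (x, y)) a)) hprod)
  have huniq := congrArg (fun T : E →L[ℝ] E →L[ℝ] E => T Z X) (hcomp.unique hL)
  simp only [hRa, hAa] at huniq
  have hsymm := (hm.isSymmSndFDerivAt (by simp)) (0, Z) (X, 0)
  rw [VectorField.lieBracket, hLa]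
  have hX : ∀ W, HasFDerivAt (fun x => fderiv ℝ (fun y => m (x, y)) a W) (L'.flip W) a := fun W => by
    simpa using! hL.clm_apply (hasFDerivAt_const W a)
  rw [(hX X).fderiv, (hX Z).fderiv]
  simp [L', A'] at huniq ⊢
  rw [← hsymm, ← huniq]
  abel

end LocalGroup

/-! ### Multiplication, conjugation and the Lie bracket in the chart at the identity -/

section LieGroupChart

variable {n : ℕ} {G : Type*} [TopologicalSpace G] [Group G]
  [ChartedSpace (EuclideanSpace ℝ (Fin n)) G]

section

variable [IsManifold (𝓡 n) 1 G]

theorem hasMFDerivAt_extChartAt_one_symm :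
    HasMFDerivAt 𝓘(ℝ, EuclideanSpace ℝ (Fin n)) (𝓡 n) (extChartAt (𝓡 n) (1 : G)).symm
      (extChartAt (𝓡 n) (1 : G) 1)
      (ContinuousLinearMap.id ℝ (EuclideanSpace ℝ (Fin n))) := by
  have h := (mdifferentiableWithinAt_extChartAt_symm (I := 𝓡 n)
    (mem_extChartAt_target (I := 𝓡 n) (1 : G))).hasMFDerivWithinAt
  have h1 := mfderivWithin_range_extChartAt_symm (I := 𝓡 n) (x := (1 : G))
  have h2 : Set.range (𝓡 n) = Set.univ := ModelWithCorners.Boundaryless.range_eq_univ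
  rw [h1, h2] at h
  exact hasMFDerivWithinAt_univ.1 h

/-- The derivative in the chart at `1` of a map `f : G → G`. -/
theorem hasFDerivAt_chart_conjugate {f : G → G}
    {A B : EuclideanSpace ℝ (Fin n) →L[ℝ] EuclideanSpace ℝ (Fin n)}
    (hf : HasMFDerivAt (𝓡 n) (𝓡 n) f 1 B)
    (hφ : HasMFDerivAt (𝓡 n) 𝓘(ℝ, EuclideanSpace ℝ (Fin n)) (extChartAt (𝓡 n) (1 : G)) (f 1) A) :
    HasFDerivAt (fun y => extChartAt (𝓡 n) (1 : G) (f ((extChartAt (𝓡 n) (1 : G)).symm y)))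
      (A.comp B) (extChartAt (𝓡 n) (1 : G) 1) := by
  have e1 : (extChartAt (𝓡 n) (1 : G)).symm (extChartAt (𝓡 n) (1 : G) 1) = 1 :=
    extChartAt_to_inv (I := 𝓡 n) (1 : G)
  have hc : HasMFDerivAt (𝓡 n) 𝓘(ℝ, EuclideanSpace ℝ (Fin n)) (extChartAt (𝓡 n) (1 : G) ∘ f)
      ((extChartAt (𝓡 n) (1 : G)).symm (extChartAt (𝓡 n) (1 : G) 1)) (A.comp B) := by
    rw [e1]
    exact hφ.comp 1 hf
  exact (hc.comp _ hasMFDerivAt_extChartAt_one_symm).hasFDerivAt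

end

variable [LieGroup (𝓡 n) ∞ G]

/-- The group law in the chart at `1`. -/
def chartMul (G : Type*) [TopologicalSpace G] [Group G] [ChartedSpace (EuclideanSpace ℝ (Fin n)) G]
    (p : EuclideanSpace ℝ (Fin n) × EuclideanSpace ℝ (Fin n)) : EuclideanSpace ℝ (Fin n) :=
  extChartAt (𝓡 n) (1 : G)
    ((extChartAt (𝓡 n) (1 : G)).symm p.1 * (extChartAt (𝓡 n) (1 : G)).symm p.2)

/-- Conjugation in the chart at `1`. -/
def chartConj (G : Type*) [TopologicalSpace G] [Group G] [ChartedSpace (EuclideanSpace ℝ (Fin n)) G]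
    (p : EuclideanSpace ℝ (Fin n) × EuclideanSpace ℝ (Fin n)) : EuclideanSpace ℝ (Fin n) :=
  extChartAt (𝓡 n) (1 : G)
    ((extChartAt (𝓡 n) (1 : G)).symm p.1 * (extChartAt (𝓡 n) (1 : G)).symm p.2 *
      ((extChartAt (𝓡 n) (1 : G)).symm p.1)⁻¹)

theorem isManifold_one_of_lieGroup : IsManifold (𝓡 n) 1 G :=
  haveI : IsManifold (𝓡 n) ∞ G := ContMDiffMul.toIsManifold
  IsManifold.of_le (n := ∞) (by simp)

theorem contMDiffAt_extChartAt_one_symm :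
    ContMDiffAt 𝓘(ℝ, EuclideanSpace ℝ (Fin n)) (𝓡 n) 2 (extChartAt (𝓡 n) (1 : G)).symm
      (extChartAt (𝓡 n) (1 : G) 1) := by
  have : IsManifold (𝓡 n) ∞ G := ContMDiffMul.toIsManifold
  have : IsManifold (𝓡 n) 2 G := IsManifold.of_le (n := ∞) (ENat.LEInfty.out)
  exact (contMDiffOn_extChartAt_symm (1 : G)).contMDiffAt
    (extChartAt_target_mem_nhds (I := 𝓡 n) (1 : G))

theorem contDiffAt_chartMul_chartConj :
    ContDiffAt ℝ 2 (chartMul (n := n) G)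
      (extChartAt (𝓡 n) (1 : G) 1, extChartAt (𝓡 n) (1 : G) 1) ∧
    ContDiffAt ℝ 2 (chartConj (n := n) G)
      (extChartAt (𝓡 n) (1 : G) 1, extChartAt (𝓡 n) (1 : G) 1) := by
  have : LieGroup (𝓡 n) 2 G := LieGroup.of_le (n := ∞) (ENat.LEInfty.out)
  have : IsManifold (𝓡 n) 2 G := ContMDiffMul.toIsManifold
  set a := extChartAt (𝓡 n) (1 : G) 1
  have ha : (extChartAt (𝓡 n) (1 : G)).symm a = 1 := extChartAt_to_inv (I := 𝓡 n) (1 : G)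
  have h1 : ContMDiffAt 𝓘(ℝ, EuclideanSpace ℝ (Fin n) × EuclideanSpace ℝ (Fin n)) (𝓡 n) 2
      (fun p : EuclideanSpace ℝ (Fin n) × EuclideanSpace ℝ (Fin n) =>
        (extChartAt (𝓡 n) (1 : G)).symm p.1) (a, a) :=
    ContMDiffAt.comp (a, a) (g := (extChartAt (𝓡 n) (1 : G)).symm) contMDiffAt_extChartAt_one_symm
      contDiffAt_fst.contMDiffAt
  have h2 : ContMDiffAt 𝓘(ℝ, EuclideanSpace ℝ (Fin n) × EuclideanSpace ℝ (Fin n)) (𝓡 n) 2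
      (fun p : EuclideanSpace ℝ (Fin n) × EuclideanSpace ℝ (Fin n) =>
        (extChartAt (𝓡 n) (1 : G)).symm p.2) (a, a) :=
    ContMDiffAt.comp (a, a) (g := (extChartAt (𝓡 n) (1 : G)).symm) contMDiffAt_extChartAt_one_symm
      contDiffAt_snd.contMDiffAt
  have hφ : ContMDiffAt (𝓡 n) 𝓘(ℝ, EuclideanSpace ℝ (Fin n)) 2 (extChartAt (𝓡 n) (1 : G)) 1 :=
    contMDiffAt_extChartAt
  have h3 := h1.mul h2
  refine ⟨ContMDiffAt.contDiffAt (ContMDiffAt.comp_of_eq (y := 1) hφ h3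
    (by rw [ha, mul_one])),
    ContMDiffAt.contDiffAt (ContMDiffAt.comp_of_eq (y := 1) hφ (h3.mul h1.inv)
    (by rw [ha, mul_inv_cancel_right]))⟩

/-- The adjoint representation, as a continuous linear map of the model space. -/
def adCLM (g : G) : EuclideanSpace ℝ (Fin n) →L[ℝ] EuclideanSpace ℝ (Fin n) :=
  mfderiv (𝓡 n) (𝓡 n) (MulAut.conj g).toMonoidHom 1

theorem mdifferentiable_conj (g : G) :
    MDifferentiable (𝓡 n) (𝓡 n) (MulAut.conj g).toMonoidHom := by
  have h : ContMDiff (𝓡 n) (𝓡 n) ∞ fun h : G => g * h * g⁻¹ :=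
    (contMDiff_const.mul contMDiff_id).mul contMDiff_const
  exact h.mdifferentiable (by simp)

theorem mdifferentiable_mul_left_lieGroup (g : G) : MDifferentiable (𝓡 n) (𝓡 n) (g * ·) :=
  (contMDiff_mul_left (n := ∞)).mdifferentiable (by simp)

theorem adCLM_eq_fderiv_chartConj {x : EuclideanSpace ℝ (Fin n)} :
    adCLM ((extChartAt (𝓡 n) (1 : G)).symm x) =
      fderiv ℝ (fun y => chartConj G (x, y)) (extChartAt (𝓡 n) (1 : G) 1) := by
  have := isManifold_one_of_lieGroup (n := n) (G := G)
  set g := (extChartAt (𝓡 n) (1 : G)).symm x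
  have h1 : ((MulAut.conj g).toMonoidHom 1 : G) = 1 := map_one _
  have hφ : HasMFDerivAt (𝓡 n) 𝓘(ℝ, EuclideanSpace ℝ (Fin n)) (extChartAt (𝓡 n) (1 : G))
      ((MulAut.conj g).toMonoidHom 1 : G) (ContinuousLinearMap.id ℝ (EuclideanSpace ℝ (Fin n))) := by
    rw [h1]
    have := (mdifferentiableAt_extChartAt (I := 𝓡 n) (mem_chart_source _ (1 : G))).hasMFDerivAt
    rwa [mfderiv_extChartAt_self] at this
  exact (hasFDerivAt_chart_conjugate (B := adCLM g) (mdifferentiable_conj (n := n) g 1).hasMFDerivAt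
    hφ).fderiv.symm

/-- Identifies left invariant fields, read in the chart, with the fields of the local group law, so
that `hasFDerivAt_local_conj` applies to the bracket of `G`. -/
theorem mpullbackWithin_mulInvariantVectorField_eventually
    (X : GroupLieAlgebra (𝓡 n) G) :
    ∀ᶠ x in 𝓝 (extChartAt (𝓡 n) (1 : G) 1),
      VectorField.mpullbackWithin 𝓘(ℝ, EuclideanSpace ℝ (Fin n)) (𝓡 n)
        (extChartAt (𝓡 n) (1 : G)).symm (mulInvariantVectorField X) (Set.range (𝓡 n)) x =
      fderiv ℝ (fun y => chartMul G (x, y)) (extChartAt (𝓡 n) (1 : G) 1) X := by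
  have := isManifold_one_of_lieGroup (n := n) (G := G)
  filter_upwards [extChartAt_target_mem_nhds (I := 𝓡 n) (1 : G)] with x hx
  rw [VectorField.mpullbackWithin_apply, ContinuousLinearMap.inverse_eq
    (mfderivWithin_extChartAt_symm_comp_mfderiv_extChartAt hx)
    (mfderiv_extChartAt_comp_mfderivWithin_extChartAt_symm hx)]
  set g := (extChartAt (𝓡 n) (1 : G)).symm x with hg
  have hgs : g ∈ (extChartAt (𝓡 n) (1 : G)).source := (extChartAt (𝓡 n) (1 : G)).map_target hx
  let A : EuclideanSpace ℝ (Fin n) →L[ℝ] EuclideanSpace ℝ (Fin n) :=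
    mfderiv (𝓡 n) 𝓘(ℝ, EuclideanSpace ℝ (Fin n)) (extChartAt (𝓡 n) (1 : G)) g
  let B : EuclideanSpace ℝ (Fin n) →L[ℝ] EuclideanSpace ℝ (Fin n) :=
    mfderiv (𝓡 n) (𝓡 n) (g * ·) (1 : G)
  have hA : HasMFDerivAt (𝓡 n) 𝓘(ℝ, EuclideanSpace ℝ (Fin n)) (extChartAt (𝓡 n) (1 : G))
      (g * 1) A := by
    rw [mul_one]
    exact (mdifferentiableAt_extChartAt (by simpa using hgs)).hasMFDerivAt
  have h2 := (hasFDerivAt_chart_conjugate (B := B)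
    (mdifferentiable_mul_left_lieGroup (n := n) g 1).hasMFDerivAt hA).fderiv
  exact (congrArg (fun T : EuclideanSpace ℝ (Fin n) →L[ℝ] EuclideanSpace ℝ (Fin n) => T X) h2).symm

/-- The bracket of the Lie algebra of `G`, in the chart at `1`. -/
theorem lie_eq_lieBracket_chart (Z X : GroupLieAlgebra (𝓡 n) G) :
    ⁅Z, X⁆ = VectorField.lieBracket ℝ
      (fun x => fderiv ℝ (fun y => chartMul G (x, y)) (extChartAt (𝓡 n) (1 : G) 1) Z)
      (fun x => fderiv ℝ (fun y => chartMul G (x, y)) (extChartAt (𝓡 n) (1 : G) 1) X)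
      (extChartAt (𝓡 n) (1 : G) 1) := by
  have := isManifold_one_of_lieGroup (n := n) (G := G)
  rw [GroupLieAlgebra.bracket_def, ← VectorField.mlieBracketWithin_univ,
    VectorField.mlieBracketWithin_apply, Set.preimage_univ, Set.univ_inter]
  have hinv : (mfderiv (𝓡 n) 𝓘(ℝ, EuclideanSpace ℝ (Fin n)) (extChartAt (𝓡 n) (1 : G)) 1 :
      EuclideanSpace ℝ (Fin n) →L[ℝ] EuclideanSpace ℝ (Fin n)).inverse =
      ContinuousLinearMap.id ℝ (EuclideanSpace ℝ (Fin n)) := by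
    rw [mfderiv_extChartAt_self]
    exact ContinuousLinearMap.inverse_id
  refine (congrArg (fun T : EuclideanSpace ℝ (Fin n) →L[ℝ] EuclideanSpace ℝ (Fin n) => T _)
    hinv).trans ?_
  have hr : Set.range (𝓡 n) = Set.univ := ModelWithCorners.Boundaryless.range_eq_univ
  have h := Filter.EventuallyEq.lieBracket_vectorField_eq (𝕜 := ℝ)
    (mpullbackWithin_mulInvariantVectorField_eventually Z)
    (mpullbackWithin_mulInvariantVectorField_eventually X)
  refine Eq.trans ?_ h
  have hW : ∀ V W : EuclideanSpace ℝ (Fin n) → EuclideanSpace ℝ (Fin n),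
      VectorField.lieBracketWithin ℝ V W (Set.range (𝓡 n)) = VectorField.lieBracket ℝ V W := by
    intro V W
    rw [hr, VectorField.lieBracketWithin_univ]
  exact congrFun (hW _ _) _

/-- The derivative of the adjoint representation at `1` is `ad`. -/
theorem exists_hasFDerivAt_adCLM :
    ∃ A' : EuclideanSpace ℝ (Fin n) →L[ℝ] EuclideanSpace ℝ (Fin n) →L[ℝ] EuclideanSpace ℝ (Fin n),
      HasFDerivAt (fun x => adCLM ((extChartAt (𝓡 n) (1 : G)).symm x)) A'
        (extChartAt (𝓡 n) (1 : G) 1) ∧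
      ∀ Z X : GroupLieAlgebra (𝓡 n) G, A' Z X = ⁅Z, X⁆ := by
  set a := extChartAt (𝓡 n) (1 : G) 1 with ha0
  have ha : (extChartAt (𝓡 n) (1 : G)).symm a = 1 := extChartAt_to_inv (I := 𝓡 n) (1 : G)
  have hright : ∀ᶠ y in 𝓝 a, extChartAt (𝓡 n) (1 : G) ((extChartAt (𝓡 n) (1 : G)).symm y) = y := by
    filter_upwards [extChartAt_target_mem_nhds (I := 𝓡 n) (1 : G)] with y hy
    exact (extChartAt (𝓡 n) (1 : G)).right_inv hy
  obtain ⟨hm, hF⟩ := contDiffAt_chartMul_chartConj (n := n) (G := G)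
  have hconj : ∀ᶠ p : EuclideanSpace ℝ (Fin n) × EuclideanSpace ℝ (Fin n) in 𝓝 (a, a),
      (extChartAt (𝓡 n) (1 : G)).symm p.1 * (extChartAt (𝓡 n) (1 : G)).symm p.2 *
      ((extChartAt (𝓡 n) (1 : G)).symm p.1)⁻¹ ∈ (extChartAt (𝓡 n) (1 : G)).source := by
    have : IsTopologicalGroup G := topologicalGroup_of_lieGroup (𝓡 n) ∞
    have hc : ContinuousAt (extChartAt (𝓡 n) (1 : G)).symm a :=
      continuousAt_extChartAt_symm (I := 𝓡 n) (1 : G)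
    have hc1 : ContinuousAt (fun p : EuclideanSpace ℝ (Fin n) × EuclideanSpace ℝ (Fin n) =>
        (extChartAt (𝓡 n) (1 : G)).symm p.1) (a, a) :=
      ContinuousAt.comp (g := (extChartAt (𝓡 n) (1 : G)).symm) hc continuousAt_fst
    have hc2 : ContinuousAt (fun p : EuclideanSpace ℝ (Fin n) × EuclideanSpace ℝ (Fin n) =>
        (extChartAt (𝓡 n) (1 : G)).symm p.2) (a, a) :=
      ContinuousAt.comp (g := (extChartAt (𝓡 n) (1 : G)).symm) hc continuousAt_snd
    refine ((hc1.mul hc2).mul hc1.inv).eventually_mem ?_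
    simp only [Pi.mul_apply, Pi.inv_apply, ha, mul_one, inv_one]
    exact extChartAt_source_mem_nhds (I := 𝓡 n) (1 : G)
  obtain ⟨A', hA', hA'2⟩ := hasFDerivAt_local_conj hm hF
    (Filter.Eventually.of_forall fun x => by
      simp only [chartConj]
      rw [ha, mul_one, mul_inv_cancel])
    (hright.mono fun y hy => by simpa [chartMul, ← ha0, ha] using hy)
    (hright.mono fun y hy => by simpa [chartMul, ← ha0, ha] using hy)
    (hconj.mono fun p hp => by
      simp only [chartMul, chartConj]
      rw [(extChartAt (𝓡 n) (1 : G)).left_inv hp, inv_mul_cancel_right])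
  refine ⟨A', ?_, fun Z X => ?_⟩
  · simp only [adCLM_eq_fderiv_chartConj]
    exact hA'
  · rw [lie_eq_lieBracket_chart]
    exact hA'2 Z X

end LieGroupChart

/-! ### Differentials of homomorphisms and the adjoint action -/

section LieGroupHom

theorem mfderiv_comp_mfderiv_of_leftInverse {n : ℕ} {G : Type*} [TopologicalSpace G]
    [ChartedSpace (EuclideanSpace ℝ (Fin n)) G] {f f' : G → G} (hf : MDifferentiable (𝓡 n) (𝓡 n) f)
    (hf' : MDifferentiable (𝓡 n) (𝓡 n) f') (h : ∀ g, f' (f g) = g) (g : G) :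
    (mfderiv (𝓡 n) (𝓡 n) f' (f g) : EuclideanSpace ℝ (Fin n) →L[ℝ] EuclideanSpace ℝ (Fin n)).comp
      (mfderiv (𝓡 n) (𝓡 n) f g : EuclideanSpace ℝ (Fin n) →L[ℝ] EuclideanSpace ℝ (Fin n)) =
      ContinuousLinearMap.id ℝ (EuclideanSpace ℝ (Fin n)) := by
  have h1 := (hf' (f g)).hasMFDerivAt.comp g (hf g).hasMFDerivAt
  have h2 : f' ∘ f = id := funext h
  rw [h2] at h1
  exact hasMFDerivAt_unique h1 (hasMFDerivAt_id g)


variable {n : ℕ} {G : Type*} [TopologicalSpace G] [Group G]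
  [ChartedSpace (EuclideanSpace ℝ (Fin n)) G] [LieGroup (𝓡 n) ∞ G]

/-- A homomorphism of Lie groups relates left invariant vector fields. -/
theorem mfderiv_mulInvariantVectorField {f : G →* G} (hf : MDifferentiable (𝓡 n) (𝓡 n) f)
    (X : GroupLieAlgebra (𝓡 n) G) (g : G) :
    mfderiv (𝓡 n) (𝓡 n) f g (mulInvariantVectorField X g) =
      mulInvariantVectorField (lieDifferential f X) (f g) := by
  have h1 : HasMFDerivAt (𝓡 n) (𝓡 n) (fun h => f (g * h)) 1
      ((mfderiv (𝓡 n) (𝓡 n) f g : EuclideanSpace ℝ (Fin n) →L[ℝ] EuclideanSpace ℝ (Fin n)).comp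
        (mfderiv (𝓡 n) (𝓡 n) (g * ·) (1 : G) :
          EuclideanSpace ℝ (Fin n) →L[ℝ] EuclideanSpace ℝ (Fin n))) := by
    have h2 : HasMFDerivAt (𝓡 n) (𝓡 n) f (g * 1) (mfderiv (𝓡 n) (𝓡 n) f g :
        EuclideanSpace ℝ (Fin n) →L[ℝ] EuclideanSpace ℝ (Fin n)) := by
      rw [mul_one]
      exact (hf g).hasMFDerivAt
    exact h2.comp (1 : G) (mdifferentiable_mul_left_lieGroup g 1).hasMFDerivAt
  have h3 : HasMFDerivAt (𝓡 n) (𝓡 n) (fun h => f (g * h)) 1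
      ((mfderiv (𝓡 n) (𝓡 n) (f g * ·) (1 : G) :
          EuclideanSpace ℝ (Fin n) →L[ℝ] EuclideanSpace ℝ (Fin n)).comp
        (mfderiv (𝓡 n) (𝓡 n) f (1 : G) :
          EuclideanSpace ℝ (Fin n) →L[ℝ] EuclideanSpace ℝ (Fin n))) := by
    have h2 : HasMFDerivAt (𝓡 n) (𝓡 n) (f g * ·) (f 1) (mfderiv (𝓡 n) (𝓡 n) (f g * ·) (1 : G) :
        EuclideanSpace ℝ (Fin n) →L[ℝ] EuclideanSpace ℝ (Fin n)) := by
      rw [map_one]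
      exact (mdifferentiable_mul_left_lieGroup (f g) 1).hasMFDerivAt
    rw [show (fun h => f (g * h)) = (f g * ·) ∘ f from funext (map_mul f g)]
    exact h2.comp (1 : G) (hf 1).hasMFDerivAt
  have h4 := hasMFDerivAt_unique h1 h3
  exact congrArg (fun T : EuclideanSpace ℝ (Fin n) →L[ℝ] EuclideanSpace ℝ (Fin n) => T X) h4

/-- Pullback of vector fields commutes with brackets and takes left invariant fields to left
invariant fields. The smooth inverse makes every `mfderiv f g` invertible, as the pullback requires.
-/
theorem lieDifferential_lie {f f' : G →* G} (hf : ContMDiff (𝓡 n) (𝓡 n) ∞ f)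
    (hf' : ContMDiff (𝓡 n) (𝓡 n) ∞ f') (h : ∀ g, f' (f g) = g) (h' : ∀ g, f (f' g) = g)
    (X Y : GroupLieAlgebra (𝓡 n) G) :
    lieDifferential f ⁅X, Y⁆ = ⁅lieDifferential f X, lieDifferential f Y⁆ := by
  have hd : MDifferentiable (𝓡 n) (𝓡 n) f := hf.mdifferentiable (by simp)
  have hd' : MDifferentiable (𝓡 n) (𝓡 n) f' := hf'.mdifferentiable (by simp)
  have hl := fun g => mfderiv_comp_mfderiv_of_leftInverse hd hd' h g
  have hr : ∀ g, (mfderiv (𝓡 n) (𝓡 n) f g :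
      EuclideanSpace ℝ (Fin n) →L[ℝ] EuclideanSpace ℝ (Fin n)).comp
      (mfderiv (𝓡 n) (𝓡 n) f' (f g) : EuclideanSpace ℝ (Fin n) →L[ℝ] EuclideanSpace ℝ (Fin n)) =
      ContinuousLinearMap.id ℝ (EuclideanSpace ℝ (Fin n)) := by
    intro g
    have := mfderiv_comp_mfderiv_of_leftInverse hd' hd h' (f g)
    rwa [h] at this
  have hpull : ∀ Z : GroupLieAlgebra (𝓡 n) G, VectorField.mpullback (𝓡 n) (𝓡 n) f
      (mulInvariantVectorField (lieDifferential f Z)) = mulInvariantVectorField Z := by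
    intro Z
    funext g
    rw [VectorField.mpullback_apply, ← mfderiv_mulInvariantVectorField hd,
      ContinuousLinearMap.inverse_eq (hr g) (hl g)]
    exact congrArg (fun T : EuclideanSpace ℝ (Fin n) →L[ℝ] EuclideanSpace ℝ (Fin n) =>
      T (mulInvariantVectorField Z g)) (hl g)
  have hb := VectorField.mpullback_mlieBracket (I := 𝓡 n) (I' := 𝓡 n) (f := f) (x₀ := (1 : G))
    (n := minSmoothness ℝ 3)
    (V := mulInvariantVectorField (lieDifferential f X))
    (W := mulInvariantVectorField (lieDifferential f Y))
    (mdifferentiableAt_mulInvariantVectorField _) (mdifferentiableAt_mulInvariantVectorField _)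
    (hf.contMDiffAt.of_le ENat.LEInfty.out) (minSmoothness_monotone (by norm_cast))
  rw [hpull, hpull, VectorField.mpullback_apply, ContinuousLinearMap.inverse_eq (hr 1) (hl 1)] at hb
  have h1 : ∀ g : G, g = 1 → (VectorField.mlieBracket (𝓡 n)
      (mulInvariantVectorField (lieDifferential f X))
      (mulInvariantVectorField (lieDifferential f Y)) g : EuclideanSpace ℝ (Fin n)) =
      (⁅lieDifferential f X, lieDifferential f Y⁆ : GroupLieAlgebra (𝓡 n) G) := by
    rintro g rfl
    rfl
  have h2 := congrArg (fun T : EuclideanSpace ℝ (Fin n) →L[ℝ] EuclideanSpace ℝ (Fin n) =>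
    T (VectorField.mlieBracket (𝓡 n) (mulInvariantVectorField (lieDifferential f X))
      (mulInvariantVectorField (lieDifferential f Y)) (f 1))) (hr 1)
  refine Eq.trans ?_ (h2.trans (h1 _ (map_one f)))
  exact congrArg (mfderiv (𝓡 n) (𝓡 n) f 1 :
    EuclideanSpace ℝ (Fin n) →L[ℝ] EuclideanSpace ℝ (Fin n)) hb.symm

theorem contMDiff_conj (g : G) : ContMDiff (𝓡 n) (𝓡 n) ∞ (MulAut.conj g).toMonoidHom :=
  ((contMDiff_const.mul contMDiff_id).mul contMDiff_const :
    ContMDiff (𝓡 n) (𝓡 n) ∞ fun h : G => g * h * g⁻¹)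

theorem adCLM_mul (g h : G) : adCLM (n := n) (g * h) = (adCLM g).comp (adCLM h) := by
  have h1 : HasMFDerivAt (𝓡 n) (𝓡 n) (MulAut.conj g).toMonoidHom ((MulAut.conj h).toMonoidHom 1 : G)
      (adCLM g) := by
    rw [map_one]
    exact (mdifferentiable_conj g 1).hasMFDerivAt
  have h2 := h1.comp 1 (mdifferentiable_conj (n := n) h 1).hasMFDerivAt
  have h3 : (MulAut.conj g).toMonoidHom ∘ (MulAut.conj h).toMonoidHom =
      ((MulAut.conj (g * h)).toMonoidHom : G → G) := by
    funext x
    simp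
  rw [h3] at h2
  exact hasMFDerivAt_unique (mdifferentiable_conj (n := n) (g * h) 1).hasMFDerivAt h2

theorem adCLM_one : adCLM (n := n) (1 : G) = ContinuousLinearMap.id ℝ _ := by
  have h3 : ((MulAut.conj (1 : G)).toMonoidHom : G → G) = id := by
    funext x
    simp
  have h := (mdifferentiable_conj (n := n) (1 : G) 1).hasMFDerivAt
  rw [h3] at h
  have h2 := hasMFDerivAt_unique h (hasMFDerivAt_id (1 : G))
  rw [adCLM, h3]
  exact h2

theorem adCLM_inv_apply (g : G) (X : EuclideanSpace ℝ (Fin n)) : adCLM g⁻¹ (adCLM g X) = X := by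
  rw [← ContinuousLinearMap.comp_apply, ← adCLM_mul, inv_mul_cancel, adCLM_one]
  rfl

/-- The adjoint representation acts by automorphisms of the Lie algebra. -/
def lieAdEquiv (g : G) : GroupLieAlgebra (𝓡 n) G ≃ₗ⁅ℝ⁆ GroupLieAlgebra (𝓡 n) G where
  toLinearMap := lieAd g
  map_lie' := lieDifferential_lie (contMDiff_conj g) (contMDiff_conj g⁻¹) (by simp [mul_assoc])
    (by simp [mul_assoc]) _ _
  invFun := lieAd g⁻¹
  left_inv X := adCLM_inv_apply g X
  right_inv X := by
    have h := adCLM_inv_apply (n := n) g⁻¹ X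
    rw [inv_inv] at h
    exact h

/-- The derivative of `Ad` along a curve tangent to a left invariant vector field. -/
theorem hasDerivAt_adCLM {c : ℝ → G} {t : ℝ} {Z : GroupLieAlgebra (𝓡 n) G}
    (hc : HasMFDerivAt 𝓘(ℝ, ℝ) (𝓡 n) c t
      ((1 : ℝ →L[ℝ] ℝ).smulRight (mulInvariantVectorField Z (c t))))
    {D : EuclideanSpace ℝ (Fin n) →L[ℝ] EuclideanSpace ℝ (Fin n)}
    (hD : ∀ X : GroupLieAlgebra (𝓡 n) G, D X = ⁅Z, X⁆) :
    HasDerivAt (fun s => adCLM (n := n) (c s)) ((adCLM (c t)).comp D) t := by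
  have := isManifold_one_of_lieGroup (n := n) (G := G)
  have hinv := mfderiv_comp_mfderiv_of_leftInverse (n := n)
    (mdifferentiable_mul_left_lieGroup (c t)) (mdifferentiable_mul_left_lieGroup (c t)⁻¹)
    (fun g => inv_mul_cancel_left (c t) g) 1
  rw [mul_one] at hinv
  -- Since `Ad(c s) = Ad(c t) Ad((c t)⁻¹ c s)`, translating the curve back to `1` reduces the claim
  -- to the derivative of `Ad` at `1`.
  have h1 : HasMFDerivAt 𝓘(ℝ, ℝ) (𝓡 n) (fun s => (c t)⁻¹ * c s) t
      ((1 : ℝ →L[ℝ] ℝ).smulRight (Z : EuclideanSpace ℝ (Fin n))) := by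
    have h2 := (mdifferentiable_mul_left_lieGroup (n := n) (c t)⁻¹ (c t)).hasMFDerivAt.comp t hc
    refine HasMFDerivAt.congr_mfderiv h2 ?_
    refine ContinuousLinearMap.ext_ring ?_
    change (mfderiv (𝓡 n) (𝓡 n) ((c t)⁻¹ * ·) (c t) :
      EuclideanSpace ℝ (Fin n) →L[ℝ] EuclideanSpace ℝ (Fin n))
      ((1 : ℝ) • (mfderiv (𝓡 n) (𝓡 n) (c t * ·) (1 : G) :
      EuclideanSpace ℝ (Fin n) →L[ℝ] EuclideanSpace ℝ (Fin n)) Z) =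
        (1 : ℝ) • (Z : EuclideanSpace ℝ (Fin n))
    rw [one_smul, one_smul]
    exact congrArg (fun T : EuclideanSpace ℝ (Fin n) →L[ℝ] EuclideanSpace ℝ (Fin n) => T Z) hinv
  have hφ : HasMFDerivAt (𝓡 n) 𝓘(ℝ, EuclideanSpace ℝ (Fin n)) (extChartAt (𝓡 n) (1 : G))
      ((c t)⁻¹ * c t) (ContinuousLinearMap.id ℝ (EuclideanSpace ℝ (Fin n))) := by
    rw [inv_mul_cancel]
    have := (mdifferentiableAt_extChartAt (I := 𝓡 n) (mem_chart_source _ (1 : G))).hasMFDerivAt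
    rwa [mfderiv_extChartAt_self] at this
  have h3 : HasDerivAt (fun s => extChartAt (𝓡 n) (1 : G) ((c t)⁻¹ * c s))
      (Z : EuclideanSpace ℝ (Fin n)) t := by
    have h4 : HasFDerivAt (fun s => extChartAt (𝓡 n) (1 : G) ((c t)⁻¹ * c s))
        ((ContinuousLinearMap.id ℝ (EuclideanSpace ℝ (Fin n))).comp
          ((1 : ℝ →L[ℝ] ℝ).smulRight (Z : EuclideanSpace ℝ (Fin n)))) t :=
      (hφ.comp t h1).hasFDerivAt
    exact h4.hasDerivAt.congr_deriv (one_smul ℝ (Z : EuclideanSpace ℝ (Fin n)))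
  obtain ⟨A', hA', hA'2⟩ := exists_hasFDerivAt_adCLM (n := n) (G := G)
  have hA'D : A' Z = D := ContinuousLinearMap.ext fun X => (hA'2 Z X).trans (hD X).symm
  have h0 : extChartAt (𝓡 n) (1 : G) 1 = extChartAt (𝓡 n) (1 : G) ((c t)⁻¹ * c t) := by
    rw [inv_mul_cancel]
  rw [h0] at hA'
  have h6 := hA'.comp_hasDerivAt t h3
  rw [hA'D] at h6
  have h7 := (ContinuousLinearMap.compL ℝ (EuclideanSpace ℝ (Fin n)) (EuclideanSpace ℝ (Fin n))
    (EuclideanSpace ℝ (Fin n)) (adCLM (c t))).hasFDerivAt.comp_hasDerivAt t h6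
  refine h7.congr_of_eventuallyEq ?_
  have h8 : ∀ᶠ s in 𝓝 t, (c t)⁻¹ * c s ∈ (extChartAt (𝓡 n) (1 : G)).source := by
    refine h1.continuousAt.eventually_mem ?_
    rw [inv_mul_cancel]
    exact extChartAt_source_mem_nhds (I := 𝓡 n) (1 : G)
  filter_upwards [h8] with s hs
  change adCLM (c s) = (adCLM (c t)).comp
    (adCLM ((extChartAt (𝓡 n) (1 : G)).symm (extChartAt (𝓡 n) (1 : G) ((c t)⁻¹ * c s))))
  rw [(extChartAt (𝓡 n) (1 : G)).left_inv hs, ← adCLM_mul, mul_inv_cancel_left]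

end LieGroupHom

/-! ### Orbits of a one-parameter group as smooth curves -/

section Flow

/-- If `A' = A ∘ a` on an interval and `ι` intertwines `D` with `a`, then `A s (ι x)` runs, after a
change of parameter, along a smooth curve in the domain of `ι`. -/
theorem exists_curve_of_hasDerivAt_comp {V E : Type*} [NormedAddCommGroup V] [NormedSpace ℝ V]
    [FiniteDimensional ℝ V] [NormedAddCommGroup E] [NormedSpace ℝ E]
    (D₀ : V →ₗ[ℝ] V) (ι₀ : V →ₗ[ℝ] E) {A : ℝ → E →L[ℝ] E} {a : E →L[ℝ] E} {ε : ℝ} (hε : 0 < ε)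
    (hA : ∀ s ∈ Set.Ioo (-ε) ε, HasDerivAt A ((A s).comp a) s)
    (hA0 : A 0 = ContinuousLinearMap.id ℝ E) (hD : ∀ y, ι₀ (D₀ y) = a (ι₀ y)) (x : V) :
    ∃ γ : ℝ → V, ContDiff ℝ ∞ γ ∧ (∀ t, ∃ s ∈ Set.Ioo (-ε) ε, ι₀ (γ t) = A s (ι₀ x)) ∧ γ 0 = x ∧
      HasDerivAt γ (D₀ x) 0 := by
  have : CompleteSpace V := FiniteDimensional.complete ℝ V
  let D : V →L[ℝ] V := LinearMap.toContinuousLinearMap D₀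
  let ι : V →L[ℝ] E := LinearMap.toContinuousLinearMap ι₀
  have hexp : ∀ s : ℝ, HasDerivAt (fun s : ℝ => NormedSpace.exp (s • D))
      (D * NormedSpace.exp (s • D)) s := fun s => hasDerivAt_exp_smul_const' D s
  have horb : ∀ t ∈ Set.Ioo (-ε) ε, ι (NormedSpace.exp (t • D) x) = A t (ι x) := by
    intro t ht
    set y := NormedSpace.exp (t • D) x with hy
    -- `A s ι exp(-sD) y` is constant because the terms from `A' = A ∘ a` and `ι D = a ι` cancel.
    -- With `y = exp(tD) x`, its values at `s = 0` and `s = t` are the two sides.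
    have hder : ∀ s ∈ Set.Ioo (-ε) ε, HasDerivAt
        (fun s : ℝ => A s (ι (NormedSpace.exp ((-s) • D) y))) 0 s := by
      intro s hs
      have h2 : HasDerivAt (fun s : ℝ => NormedSpace.exp ((-s) • D))
          (-(D * NormedSpace.exp ((-s) • D))) s := by
        exact ((hexp (-s)).scomp s (hasDerivAt_neg s)).congr_deriv (neg_one_smul ℝ _)
      have h3 : HasDerivAt (fun s : ℝ => NormedSpace.exp ((-s) • D) y)
          (-(D (NormedSpace.exp ((-s) • D) y))) s := by
        simpa using! h2.clm_apply (hasDerivAt_const s y)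
      have h4 := (hA s hs).clm_apply (ι.hasFDerivAt.comp_hasDerivAt s h3)
      refine h4.congr_deriv ?_
      have h5 : a (ι (NormedSpace.exp ((-s) • D) y)) = ι (D (NormedSpace.exp ((-s) • D) y)) :=
        (hD _).symm
      rw [ContinuousLinearMap.comp_apply, Function.comp_apply, h5, map_neg, map_neg,
        add_neg_cancel]
    have h0 : (0 : ℝ) ∈ Set.Ioo (-ε) ε := ⟨by linarith, hε⟩
    have hconst := isOpen_Ioo.is_const_of_deriv_eq_zero isPreconnected_Ioo
      (fun s hs => (hder s hs).differentiableAt.differentiableWithinAt)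
      (fun s hs => (hder s hs).deriv) h0 ht
    let _ : NormedAlgebra ℚ (V →L[ℝ] V) := NormedAlgebra.restrictScalars ℚ ℝ (V →L[ℝ] V)
    have h6 : NormedSpace.exp ((-t) • D) y = x := by
      rw [hy, ← mul_apply_eq_comp, ← NormedSpace.exp_add_of_commute]
      · simp
      · exact (Commute.refl D).smul_left _ |>.smul_right _
    simp only [h6, hA0, neg_zero, zero_smul, NormedSpace.exp_zero] at hconst
    exact hconst
  -- A smooth reparametrization of the whole line into `(-ε, ε)` with `ρ(0) = 0` and `ρ'(0) = 1`,
  -- which keeps the velocity at `0`.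
  let ρ : ℝ → ℝ := fun t => ε / 2 * Real.sin (2 / ε * t)
  have hρ : ContDiff ℝ ∞ ρ := contDiff_const.mul 
    (Real.contDiff_sin.comp (contDiff_const.mul contDiff_id))
  have hρmem : ∀ t, ρ t ∈ Set.Ioo (-ε) ε := fun t => by
    have h1 := Real.sin_le_one (2 / ε * t)
    have h2 := Real.neg_one_le_sin (2 / ε * t)
    constructor <;> simp only [ρ] <;> nlinarith
  have hρ0 : ρ 0 = 0 := by simp [ρ]
  have hρ' : HasDerivAt ρ 1 0 := by
    have h1 : HasDerivAt (fun t : ℝ => 2 / ε * t) (2 / ε) 0 := by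
      simpa using (hasDerivAt_id (0 : ℝ)).const_mul (2 / ε)
    have h2 := (h1.sin).const_mul (ε / 2)
    refine h2.congr_deriv ?_
    rw [mul_zero, Real.cos_zero]
    field_simp
  refine ⟨fun t => NormedSpace.exp (ρ t • D) x, ?_, fun t => ⟨ρ t, hρmem t, horb _ (hρmem t)⟩, ?_, ?_⟩
  · have h1 : ContDiff ℝ ∞ (NormedSpace.exp : (V →L[ℝ] V) → (V →L[ℝ] V)) :=
      AnalyticOnNhd.contDiff fun y _ => NormedSpace.exp_analytic y
    exact (h1.comp (hρ.smul contDiff_const)).clm_apply contDiff_const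
  · simp [hρ0]
  · have h1 := hexp (ρ 0)
    have h2 := (h1.scomp 0 hρ').clm_apply (hasDerivAt_const 0 x)
    simpa [hρ0] using! h2

end Flow

/-! ### Curves in `K` and in its orbits -/

section Curves

variable {n : ℕ} {G : Type*} [TopologicalSpace G] [Group G]
  [ChartedSpace (EuclideanSpace ℝ (Fin n)) G] [LieGroup (𝓡 n) ∞ G]

instance : Module.Finite ℝ (GroupLieAlgebra (𝓡 n) G) :=
  inferInstanceAs (Module.Finite ℝ (EuclideanSpace ℝ (Fin n)))

namespace CompactSymmetricPair

variable (S : CompactSymmetricPair n G)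

instance : FiniteDimensional ℝ S.P := inferInstanceAs (FiniteDimensional ℝ S.pSubmodule)

theorem lieDifferential_σ_lie (X Y : GroupLieAlgebra (𝓡 n) G) :
    lieDifferential S.σ ⁅X, Y⁆ = ⁅lieDifferential S.σ X, lieDifferential S.σ Y⁆ :=
  lieDifferential_lie S.σ_smooth S.σ_smooth S.σ_involutive S.σ_involutive X Y

theorem lieDifferential_σ_involutive (X : GroupLieAlgebra (𝓡 n) G) :
    lieDifferential S.σ (lieDifferential S.σ X) = X := by
  have hd : MDifferentiable (𝓡 n) (𝓡 n) S.σ := S.σ_smooth.mdifferentiable (by simp)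
  have h := mfderiv_comp_mfderiv_of_leftInverse (n := n) hd hd S.σ_involutive 1
  rw [map_one] at h
  exact congrArg (fun T : EuclideanSpace ℝ (Fin n) →L[ℝ] EuclideanSpace ℝ (Fin n) => T X) h

theorem lieDifferential_σ_of_mem {X : GroupLieAlgebra (𝓡 n) G} (hX : X ∈ S.pSubmodule) :
    lieDifferential S.σ X = -X := by
  have := Module.End.mem_eigenspace_iff.1 hX
  rwa [neg_smul, one_smul] at this

theorem lieDifferential_σ_incl (X : S.P) : lieDifferential S.σ (S.incl X) = -S.incl X :=
  S.lieDifferential_σ_of_mem X.2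

/-- Near `0` the one-parameter group of a vector fixed by `dσ` runs in `K`. -/
theorem exists_curve_in_K [T2Space G] {Z : GroupLieAlgebra (𝓡 n) G}
    (hZ : lieDifferential S.σ Z = Z) :
    ∃ ε > 0, ∃ c : ℝ → G, c 0 = 1 ∧ ∀ t ∈ Set.Ioo (-ε) ε, c t ∈ S.K ∧
      HasMFDerivAt 𝓘(ℝ, ℝ) (𝓡 n) c t
        ((1 : ℝ →L[ℝ] ℝ).smulRight (mulInvariantVectorField Z (c t))) := by
  have := isManifold_one_of_lieGroup (n := n) (G := G)
  have hd : MDifferentiable (𝓡 n) (𝓡 n) S.σ := S.σ_smooth.mdifferentiable (by simp)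
  have hv : ContMDiff (𝓡 n) (𝓡 n).tangent 1
      (fun g : G => (⟨g, mulInvariantVectorField Z g⟩ : TangentBundle (𝓡 n) G)) :=
    (contMDiff_mulInvariantVectorField Z).of_le
      (le_trans (by norm_num) (le_minSmoothness (𝕜 := ℝ) (n := 2)))
  obtain ⟨c, hc0, hc⟩ := exists_isMIntegralCurveAt_of_contMDiffAt_boundaryless (t₀ := 0)
    (hv.contMDiffAt (x := 1))
  obtain ⟨ε, hε, hcε⟩ := isMIntegralCurveAt_iff'.1 hc
  rw [Real.ball_eq_Ioo, zero_sub, zero_add] at hcε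
  have hderiv : ∀ t ∈ Set.Ioo (-ε) ε, HasMFDerivAt 𝓘(ℝ, ℝ) (𝓡 n) c t
      ((1 : ℝ →L[ℝ] ℝ).smulRight (mulInvariantVectorField Z (c t))) := fun t ht =>
    (hcε t ht).hasMFDerivAt (isOpen_Ioo.mem_nhds ht)
  have h0 : (0 : ℝ) ∈ Set.Ioo (-ε) ε := ⟨by linarith, hε⟩
  -- As `dσ Z = Z`, the curve `σ ∘ c` solves the same equation with the same initial value, so
  -- uniqueness makes `c` pointwise fixed by `σ`.
  have hσc : IsMIntegralCurveOn (fun t => S.σ (c t)) (mulInvariantVectorField (I := 𝓡 n) Z)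
      (Set.Ioo (-ε) ε) := by
    intro t ht
    have h1 := (hd (c t)).hasMFDerivAt.comp t (hderiv t ht)
    refine HasMFDerivAt.hasMFDerivWithinAt (HasMFDerivAt.congr_mfderiv h1 ?_)
    refine ContinuousLinearMap.ext_ring ?_
    change (mfderiv (𝓡 n) (𝓡 n) S.σ (c t) :
      EuclideanSpace ℝ (Fin n) →L[ℝ] EuclideanSpace ℝ (Fin n))
      ((1 : ℝ) • (mulInvariantVectorField Z (c t) : EuclideanSpace ℝ (Fin n))) =
        (1 : ℝ) • (mulInvariantVectorField Z (S.σ (c t)) : EuclideanSpace ℝ (Fin n))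
    rw [one_smul, one_smul]
    have h2 := mfderiv_mulInvariantVectorField hd Z (c t)
    rw [hZ] at h2
    exact h2
  have hfix : Set.EqOn (fun t => S.σ (c t)) c (Set.Ioo (-ε) ε) :=
    isMIntegralCurveOn_Ioo_eqOn_of_contMDiff_boundaryless h0 hv hσc hcε
      (by simp [hc0])
  refine ⟨ε, hε, c, hc0, fun t ht => ⟨?_, hderiv t ht⟩⟩
  have hcont : ContinuousOn c (Set.Ioo (-ε) ε) := fun s hs =>
    (hderiv s hs).continuousAt.continuousWithinAt
  -- The image of the interval is connected and contains `1`, so it stays in the identity component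
  -- of the fixed points.
  have hsub : c '' Set.Ioo (-ε) ε ⊆ connectedComponentIn {g : G | S.σ g = g} 1 := by
    refine (isPreconnected_Ioo.image c hcont).subset_connectedComponentIn ⟨0, h0, hc0⟩ ?_
    rintro _ ⟨s, hs, rfl⟩
    exact hfix hs
  exact S.fixed_component_le (hsub ⟨t, ht, rfl⟩)

/-- `ad Z` as an endomorphism of `𝔭`, for `Z` fixed by `dσ`. -/
theorem exists_ad_endomorphism {Z : GroupLieAlgebra (𝓡 n) G} (hZ : lieDifferential S.σ Z = Z) :
    ∃ D : S.P →ₗ[ℝ] S.P, ∀ y, S.incl (D y) = ⁅Z, S.incl y⁆ := by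
  have hmem : ∀ y ∈ S.pSubmodule, LieAlgebra.ad ℝ (GroupLieAlgebra (𝓡 n) G) Z y ∈ S.pSubmodule := by
    intro y hy
    refine Module.End.mem_eigenspace_iff.2 ?_
    rw [LieAlgebra.ad_apply, S.lieDifferential_σ_lie, hZ, S.lieDifferential_σ_of_mem hy, lie_neg,
      neg_smul, one_smul]
  let D₀ : S.P →ₗ[ℝ] S.P :=
    (LieAlgebra.ad ℝ (GroupLieAlgebra (𝓡 n) G) Z : Module.End ℝ (GroupLieAlgebra (𝓡 n) G)).restrict
      hmem
  exact ⟨D₀, fun _ => rfl⟩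

/-- The vectors `[Z, x]`, with `Z` fixed by `dσ`, are tangent to the orbit of `x`. -/
theorem exists_orbit_curve [T2Space G] {Z : GroupLieAlgebra (𝓡 n) G}
    (hZ : lieDifferential S.σ Z = Z) {x v : S.P} (hv : S.incl v = ⁅Z, S.incl x⁆) :
    ∃ γ : ℝ → S.P, ContDiff ℝ ∞ γ ∧ (∀ t, γ t ∈ S.adOrbit x) ∧ γ 0 = x ∧ HasDerivAt γ v 0 := by
  obtain ⟨ε, hε, c, hc0, hc⟩ := S.exists_curve_in_K hZ
  obtain ⟨D, hD⟩ := S.exists_ad_endomorphism hZ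
  obtain rfl : D x = v := S.incl_injective (by rw [hD, hv])
  let adZ : EuclideanSpace ℝ (Fin n) →L[ℝ] EuclideanSpace ℝ (Fin n) :=
    LinearMap.toContinuousLinearMap (LieAlgebra.ad ℝ (GroupLieAlgebra (𝓡 n) G) Z :
      EuclideanSpace ℝ (Fin n) →ₗ[ℝ] EuclideanSpace ℝ (Fin n))
  obtain ⟨γ, hγ, horb, hγ0, hγ'⟩ := exists_curve_of_hasDerivAt_comp (V := S.P)
    (E := EuclideanSpace ℝ (Fin n)) D S.incl (A := fun s => adCLM (c s)) (a := adZ) hε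
    (fun s hs => hasDerivAt_adCLM (hc s hs).2 fun _ => rfl) (by simp only [hc0, adCLM_one]) hD x
  refine ⟨γ, hγ, fun t => ?_, hγ0, hγ'⟩
  obtain ⟨s, hs, h⟩ := horb t
  exact ⟨c s, (hc s hs).1, h⟩

end CompactSymmetricPair

end Curves

/-! ### Root spaces in `𝔭` and the tangent space of the orbit -/

section OrbitTangentSpace

variable {n : ℕ} {G : Type*} [TopologicalSpace G] [Group G]
  [ChartedSpace (EuclideanSpace ℝ (Fin n)) G] [LieGroup (𝓡 n) ∞ G]

theorem rootSpaceG_eq_jointSpace (𝔥 : Submodule ℝ (GroupLieAlgebra (𝓡 n) G))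
    (α : Module.Dual ℝ 𝔥) : rootSpaceG 𝔥 α = jointSpace 𝔥 fun H => -(α H) ^ 2 := by
  ext X
  rw [mem_jointSpace]
  rfl

namespace CompactSymmetricPair

variable (S : CompactSymmetricPair n G)

theorem map_incl_rootSpaceP (𝔥 : Submodule ℝ (GroupLieAlgebra (𝓡 n) G)) (α : Module.Dual ℝ 𝔥) :
    (S.rootSpaceP 𝔥 α).map S.incl =
      jointSpace 𝔥 (fun H => -(α H) ^ 2) ⊓
        Module.End.eigenspace (lieDifferential S.σ) (-1) := by
  rw [rootSpaceP, rootSpaceG_eq_jointSpace]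
  ext X
  constructor
  · rintro ⟨Y, hY, rfl⟩
    exact ⟨hY, Y.2⟩
  · rintro ⟨h1, h2⟩
    exact ⟨⟨X, h2⟩, h1, rfl⟩

/-- The root spaces of the positive roots in `𝔭` are independent. -/
theorem iSupIndep_rootSpaceP {𝔥 : Submodule ℝ (GroupLieAlgebra (𝓡 n) G)}
    (hab : ∀ X ∈ 𝔥, ∀ Y ∈ 𝔥, ⁅X, Y⁆ = 0) {Φ P : Set (Module.Dual ℝ 𝔥)}
    (hP : IsPositiveSystem Φ P) (p : Module.Dual ℝ 𝔥 → Prop) :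
    iSupIndep (fun α : {α : Module.Dual ℝ 𝔥 // α ∈ P ∧ p α} => S.rootSpaceP 𝔥 α.1) := by
  have hinj : Function.Injective
      (fun (α : {α : Module.Dual ℝ 𝔥 // α ∈ P ∧ p α}) (H : 𝔥) => -(α.1 H) ^ 2) := by
    intro α β h
    exact Subtype.ext (hP.sq_injOn α.2.1 β.2.1 fun H => neg_injective (congrFun h H))
  have hind := (jointSpace_decomposition S.killing_neg hab).1.comp hinj
  intro α
  rw [Submodule.disjoint_def]
  intro X hX hX'
  have h1 : S.incl X ∈ jointSpace 𝔥 fun H => -(α.1 H) ^ 2 := by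
    rw [← rootSpaceG_eq_jointSpace]
    exact hX
  have h2 : S.incl X ∈ ⨆ β, ⨆ (_ : β ≠ α), jointSpace 𝔥 fun H => -(β.1 H) ^ 2 := by
    have h3 := Submodule.mem_map_of_mem (f := S.incl) hX'
    simp only [Submodule.map_iSup, map_incl_rootSpaceP] at h3
    refine SetLike.le_def.1 (iSup₂_mono fun β _ => ?_) h3
    exact inf_le_left
  exact S.incl_injective (((Submodule.disjoint_def.1 (hind α)) _ h1 h2).trans (map_zero _).symm)

/-- The sum of the root spaces of the roots not vanishing at `x` lies in `[𝔨, x]`. -/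
theorem exists_lie_eq_of_mem_iSup {𝔥 : Submodule ℝ (GroupLieAlgebra (𝓡 n) G)}
    (P : Set (Module.Dual ℝ 𝔥)) {x : S.P} (hx : S.incl x ∈ 𝔥) {v : S.P}
    (hv : v ∈ ⨆ α : {α : Module.Dual ℝ 𝔥 // α ∈ P ∧ α ⟨S.incl x, hx⟩ ≠ 0}, S.rootSpaceP 𝔥 α.1) :
    ∃ Z : GroupLieAlgebra (𝓡 n) G, lieDifferential S.σ Z = Z ∧ S.incl v = ⁅Z, S.incl x⁆ := by
  induction hv using Submodule.iSup_induction' with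
  | mem α X hX =>
    have h1 : ⁅S.incl x, ⁅S.incl x, S.incl X⁆⁆ = (-(α.1 ⟨S.incl x, hx⟩) ^ 2) • S.incl X :=
      hX ⟨S.incl x, hx⟩
    -- The scalar inverts `[x,[x,X]] = -α(x)² X`, the sign being absorbed by skew symmetry; a
    -- bracket of two elements of `𝔭` is fixed by `dσ`.
    refine ⟨((α.1 ⟨S.incl x, hx⟩) ^ 2)⁻¹ • ⁅S.incl x, S.incl X⁆, ?_, ?_⟩
    · rw [map_smul, S.lieDifferential_σ_lie, S.lieDifferential_σ_incl, S.lieDifferential_σ_incl,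
        neg_lie, lie_neg, neg_neg]
    · rw [smul_lie, ← lie_skew, h1, ← neg_smul, neg_neg, smul_smul,
        inv_mul_cancel₀ (pow_ne_zero 2 α.2.2), one_smul]
  | zero => exact ⟨0, map_zero _, by rw [map_zero, zero_lie]⟩
  | add X Y _ _ hX hY =>
    obtain ⟨Z, hZ, hZX⟩ := hX
    obtain ⟨W, hW, hWY⟩ := hY
    exact ⟨Z + W, by rw [map_add, hZ, hW], by rw [map_add, add_lie, hZX, hWY]⟩

/-- Velocities of curves in the orbit of `x` lie in the sum of the root spaces of the positive
roots not vanishing at `x`. -/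
theorem mem_iSup_of_hasDerivAt_orbit {𝔥 : Submodule ℝ (GroupLieAlgebra (𝓡 n) G)}
    (hab : ∀ X ∈ 𝔥, ∀ Y ∈ 𝔥, ⁅X, Y⁆ = 0) (h𝔭 : 𝔥 ≤ S.pSubmodule)
    {P : Set (Module.Dual ℝ 𝔥)} (hP : IsPositiveSystem (restrictedRoots 𝔥) P)
    {x : S.P} (hx : S.incl x ∈ 𝔥) {γ : ℝ → S.P} {v : S.P} (horb : ∀ t, γ t ∈ S.adOrbit x)
    (hγ0 : γ 0 = x) (hγ : HasDerivAt γ v 0) :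
    v ∈ ⨆ α : {α : Module.Dual ℝ 𝔥 // α ∈ P ∧ α ⟨S.incl x, hx⟩ ≠ 0}, S.rootSpaceP 𝔥 α.1 := by
  have h1 := neg_eigenspace_le_iSup_sup_centralizer S.killing_neg hab S.lieDifferential_σ_lie
    S.lieDifferential_σ_involutive h𝔭 hP
    (fun α hα hne => ⟨hα, by rwa [rootSpaceG_eq_jointSpace]⟩) ⟨S.incl x, hx⟩ v.2
  simp only [← map_incl_rootSpaceP, ← Submodule.map_iSup] at h1
  -- Here `v = u + Y` with `u = [Z, x]` a sum of root vectors and `Y` centralizing `x`; the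
  -- isospectral argument forces `Y = 0`.
  obtain ⟨_, ⟨u, hu, rfl⟩, Y, ⟨hY, -⟩, huY⟩ := Submodule.mem_sup.1 h1
  obtain ⟨Z, -, hZ⟩ := S.exists_lie_eq_of_mem_iSup P hx hu
  have h2 : LieAlgebra.ad ℝ (GroupLieAlgebra (𝓡 n) G) Y = 0 :=
    ad_eq_zero_of_hasDerivAt_orbit (V := S.P) S.incl hγ0 hγ
      (isSemisimple_ad_of_killingForm_neg S.killing_neg _)
      (fun t => by
        obtain ⟨k, -, hk⟩ := horb t
        exact ⟨lieAdEquiv k, hk⟩)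
      (Z := Z) (Y := Y) (huY.symm.trans (by rw [hZ])) hY
  have hY0 := eq_zero_of_ad_eq_zero S.killing_neg h2
  rw [hY0, add_zero] at huY
  rwa [← S.incl_injective huY]

end CompactSymmetricPair

end OrbitTangentSpace

end

theorem mainTheorem4 {n : ℕ} {G : Type*} [TopologicalSpace G] [T2Space G] [ConnectedSpace G]
    [Group G] [ChartedSpace (EuclideanSpace ℝ (Fin n)) G] [LieGroup (𝓡 n) ∞ G]
    (S : CompactSymmetricPair n G)
    (𝔥 : Submodule ℝ (GroupLieAlgebra (𝓡 n) G)) (h𝔥 : S.IsMaximalAbelian 𝔥)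
    (Φpos : Set (Module.Dual ℝ 𝔥)) (hΦ : IsPositiveSystem (restrictedRoots 𝔥) Φpos)
    (x : S.P) (hx : S.incl x ∈ 𝔥) :
    iSupIndep (fun α : {α : Module.Dual ℝ 𝔥 // α ∈ Φpos ∧ α ⟨S.incl x, hx⟩ ≠ 0} =>
      S.rootSpaceP 𝔥 α.1) ∧
    submanifoldTangentSpace (S.adOrbit x) x =
      euclideanParallelTransport 0 x ''
        ((⨆ α : {α : Module.Dual ℝ 𝔥 // α ∈ Φpos ∧ α ⟨S.incl x, hx⟩ ≠ 0},
          S.rootSpaceP 𝔥 α.1).atZero : Set (TangentSpace 𝓘(ℝ, S.P) (0 : S.P))) := by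

  have hab := h𝔥.prop.2
  refine ⟨S.iSupIndep_rootSpaceP hab hΦ _, ?_⟩
  ext v
  constructor
  · rintro ⟨γ, -, horb, hγ0, hγ⟩
    -- Parallel translation is the identity on underlying vectors, so `v` serves as its own
    -- preimage.
    exact ⟨v, S.mem_iSup_of_hasDerivAt_orbit hab h𝔥.prop.1 hΦ hx horb hγ0 hγ, rfl⟩
  · rintro ⟨w, hw, rfl⟩
    obtain ⟨Z, hZ, hZw⟩ := S.exists_lie_eq_of_mem_iSup Φpos hx hw
    exact S.exists_orbit_curve hZ hZw
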